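/- **Setting (RShadow with the local Clifford group).** Let $\mathsf{Cl}_2$ be the single-qubit Clifford group (the normalizer of the Pauli group in $U(2)$, modulo phases). Let $\Lambda$ be a completely positive trace-preserving map on $n$-qubit operators (gate-independent, time-stationary noise), with $Z$-basis average fidelity $F_Z=2^{-n}\sum_{b\in\{0,1\}^n}\langle b|\Lambda(|b\rangle\langle b|)|b\rangle$. One *round* on a state $\sigma$ draws $U=\bigotimes_{i=1}^n U_i$ uniformly from $\mathsf{Cl}_2^{\otimes n}$ and measures $\Lambda(U\sigma U^\dagger)$ in the computational basis, with outcome $b$. *Calibration:* run $NK$ independent rounds on a state $\rho_{\mathbf 0}$. For $z\in\{0,1\}^n$ put $P_z=\bigotimes_i Z^{z_i}$ and compute $\hat f_z^{(r)}=\langle b|UP_zU^\dagger|b\rangle$ in each round; $\hat f_z$ is the median of the $K$ means over groups of $N$ rounds. Put $\widehat{\mathcal M}^{-1}=\sum_z\hat f_z^{-1}\Pi_z$, where $\Pi_z$ is the orthogonal projector (for the Hilbert–Schmidt inner product) onto the span of the Pauli operators whose non-identity factors are exactly at the positions $i$ with $z_i=1$. *Estimation:* one round on a state $\rho$ gives $\hat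 o=\mathrm{Tr}\big(O\,\widehat{\mathcal M}^{-1}(U^\dagger|b\rangle\langle b|U)\big)$; $\mathbb E(\hat o)$ is the expectation over this round, for fixed calibration data. An observable is $k$-local if it is $\tilde O_S\otimes I$ for some set $S$ of $k$ qubits. **Theorem.** For every $\eta>0$ there is a constant $C>0$, depending only on $\eta$, with the following property. Let $0\le k\le n$ be integers, $\varepsilon>0$, $0<\delta<1$, $\xi_{SP}\in\mathbb R$ with $x:=\varepsilon+2k\xi_{SP}<1$, and suppose $F_Z\ge\frac12+\eta$. Suppose that the calibration state is a product $\rho_{\mathbf 0}=\bigotimes_{i=1}^n\rho_{0,i}$ with $\langle0|\rho_{0,i}|0\rangle\ge1-\xi_{SP}$ for all $i$. Put $$N_0=\Big\lceil\frac{34\cdot3^k}{\varepsilon^2(2F_Z-1)^2}\Big\rceil,\qquad K_0=\Big\lceil2\ln\frac{2n^k}{\delta}\Big\rceil .$$ Then $$N_0K_0\le C\cdot3^k\,\varepsilon^{-2}F_Z^{-2}\,\big(k\ln n+\ln(2/\delta)\big)=\tilde{\mathcal O}(3^k\varepsilon^{-2}F_Z^{-2})$$ (with $k\ln n:=0$ if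 $k=0$), and for all $N\ge N_0$, $K\ge K_0$, with probability at least $1-\delta$ over the calibration data, $\hat f_z\neq0$ for all $z$ with at most $k$ ones and, simultaneously for all $k$-local Hermitian $O$ and all $n$-qubit states $\rho$, $$\big|\mathbb E(\hat o)-\mathrm{Tr}(O\rho)\big|\le\Big(x+\frac{x^2}{1-x}\Big)2^k\|O\|_\infty ,$$ that is, $\le(\varepsilon+2k\xi_{SP})2^k\|O\|_\infty$ up to the first order in $\varepsilon$ and $k\xi_{SP}$. -/

import Mathlib

open MeasureTheory Matrix
open scoped ComplexOrder

noncomputable section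

namespace RShadow

/-! ### States, channels, and measurement in the computational basis -/

/-- Linear operators on the Hilbert space with computational basis `ι`. -/
abbrev Op (ι : Type) : Type := Matrix ι ι ℂ

/-- Bit strings of length `n`; they label the computational basis of `n` qubits. -/
abbrev Bits (n : ℕ) : Type := Fin n → Fin 2

/-- Density operators. -/
structure State (ι : Type) [Fintype ι] where
  mat : Op ι
  posSemidef : mat.PosSemidef
  trace_eq_one : mat.trace = 1

/-- The map `id_m ⊗ E` on operators on `ℂ^m ⊗ ℂ^ι`. -/
def amplify {ι : Type} (m : ℕ) (E : Op ι →ₗ[ℂ] Op ι) (X : Op (Fin m × ι)) : Op (Fin m × ι) :=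
  fun p q => E (fun a b => X (p.1, a) (q.1, b)) p.2 q.2

/-- Quantum channels: completely positive trace-preserving linear maps. -/
structure Channel (ι : Type) [Fintype ι] where
  map : Op ι →ₗ[ℂ] Op ι
  completelyPositive : ∀ (m : ℕ) (X : Op (Fin m × ι)), X.PosSemidef → (amplify m map X).PosSemidef
  tracePreserving : ∀ X : Op ι, (map X).trace = X.trace

variable {ι : Type} [Fintype ι]

theorem Channel.positive (E : Channel ι) {X : Op ι} (hX : X.PosSemidef) :
    (E.map X).PosSemidef := by
  have h1 : (X.submatrix (Prod.snd : Fin 1 × ι → ι) Prod.snd).PosSemidef := hX.submatrix _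
  have h2 := (E.completelyPositive 1 _ h1).submatrix (fun a : ι => ((0 : Fin 1), a))
  exact h2

/-- The state `E(ρ)`. -/
def Channel.apply (E : Channel ι) (ρ : State ι) : State ι where
  mat := E.map ρ.mat
  posSemidef := E.positive ρ.posSemidef
  trace_eq_one := by rw [E.tracePreserving, ρ.trace_eq_one]

/-- The state `U ρ U†`. -/
def State.conj [DecidableEq ι] (ρ : State ι) (U : unitaryGroup ι ℂ) : State ι where
  mat := U.1 * ρ.mat * U.1ᴴ
  posSemidef := ρ.posSemidef.mul_mul_conjTranspose_same U.1
  trace_eq_one := by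
    have h : U.1ᴴ * U.1 = 1 := mem_unitaryGroup_iff'.1 U.2
    rw [trace_mul_comm, ← Matrix.mul_assoc, h, Matrix.one_mul, ρ.trace_eq_one]

/-- The Born rule: the outcome distribution of a computational basis measurement. -/
def State.measure (ρ : State ι) : PMF ι :=
  PMF.ofFintype (fun b => ENNReal.ofReal (ρ.mat b b).re) (by
    rw [← ENNReal.ofReal_sum_of_nonneg
      (fun b _ => (Complex.nonneg_iff.1 ρ.posSemidef.diag_nonneg).1)]
    have h : ∑ b, (ρ.mat b b).re = 1 := by
      have := congrArg Complex.re ρ.trace_eq_one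
      simpa [Matrix.trace] using this
    rw [h, ENNReal.ofReal_one])

/-- The Hilbert–Schmidt inner product `⟨⟨A|B⟩⟩ = tr(A† B)`. -/
def hs (A B : Op ι) : ℂ := (Aᴴ * B).trace

/-- The projector `|b⟩⟨b|`. -/
def ketbra [DecidableEq ι] (b : ι) : Op ι := Matrix.single b b 1

/-- The operator norm (largest singular value) `‖A‖_∞`. -/
def opNorm [DecidableEq ι] (A : Op ι) : ℝ := ‖Matrix.toEuclideanCLM (𝕜 := ℂ) A‖

/-- The tensor product `⊗ᵢ Aᵢ` of single-qubit operators. -/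
def tensor {n : ℕ} (A : Fin n → Op (Fin 2)) : Op (Bits n) :=
  fun x y => ∏ i, A i (x i) (y i)

/-- `F(|0⟩⟨0|, ρ) = ⟨0|ρ|0⟩`. -/
def fidelityZero (ρ : State (Fin 2)) : ℝ := (hs (ketbra 0) ρ.mat).re

/-- The `Z`-basis average fidelity `2⁻ⁿ ∑_b ⟨⟨b|Λ|b⟩⟩`. -/
def zFidelity {n : ℕ} (Λ : Channel (Bits n)) : ℝ :=
  (2 ^ n)⁻¹ * ∑ b, (hs (ketbra b) (Λ.map (ketbra b))).re

/-- `O = Õ_S ⊗ I` on the complement of some set `S` of `k` qubits. -/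
def IsLocal {n : ℕ} (k : ℕ) (O : Op (Bits n)) : Prop :=
  ∃ S : Finset (Fin n), S.card = k ∧ ∃ T : Op (S → Fin 2), ∀ x y : Bits n,
    O x y = T (fun i => x i) (fun i => y i) * if ∀ i, i ∉ S → x i = y i then 1 else 0

/-! ### Pauli and Clifford groups -/

/-- The Pauli matrices `I, X, Y, Z`. -/
def pauli : Fin 4 → Op (Fin 2) :=
  ![1, !![0, 1; 1, 0], !![0, -Complex.I; Complex.I, 0], !![1, 0; 0, -1]]

theorem pauli_conjTranspose (p : Fin 4) : (pauli p)ᴴ = pauli p := by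
  fin_cases p <;> ext i j <;> fin_cases i <;> fin_cases j <;> simp [pauli]

theorem pauli_mul (p q : Fin 4) :
    ∃ (c : ℂ) (r : Fin 4), c ^ 4 = 1 ∧ pauli p * pauli q = c • pauli r := by
  have key : ∃ m : ℕ, ∃ r : Fin 4, pauli p * pauli q = (Complex.I ^ m) • pauli r := by
    fin_cases p <;> fin_cases q
    · exact ⟨0, 0, by simp [pauli]⟩
    · exact ⟨0, 1, by simp [pauli]⟩
    · exact ⟨0, 2, by simp [pauli]⟩
    · exact ⟨0, 3, by simp [pauli]⟩
    · exact ⟨0, 1, by simp [pauli]⟩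
    · exact ⟨0, 0, by simp [pauli, Matrix.one_fin_two]⟩
    · exact ⟨1, 3, by simp [pauli]⟩
    · exact ⟨3, 2, by simp [pauli, Complex.I_pow_three]⟩
    · exact ⟨0, 2, by simp [pauli]⟩
    · exact ⟨3, 3, by simp [pauli, Complex.I_pow_three]⟩
    · exact ⟨0, 0, by simp [pauli, Matrix.one_fin_two]⟩
    · exact ⟨1, 1, by simp [pauli]⟩
    · exact ⟨0, 3, by simp [pauli]⟩
    · exact ⟨1, 2, by simp [pauli]⟩
    · exact ⟨3, 1, by simp [pauli, Complex.I_pow_three]⟩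
    · exact ⟨0, 0, by simp [pauli, Matrix.one_fin_two]⟩
  obtain ⟨m, r, h⟩ := key
  exact ⟨_, r, by rw [← pow_mul, mul_comm, pow_mul, Complex.I_pow_four, one_pow], h⟩

/-- The single-qubit Pauli group: the products of `I, X, Y, Z` with a fourth root of unity. -/
def pauliGroup : Subgroup (unitaryGroup (Fin 2) ℂ) where
  carrier := {U | ∃ (c : ℂ) (p : Fin 4), c ^ 4 = 1 ∧ U.1 = c • pauli p}
  one_mem' := ⟨1, 0, by simp, by simp [pauli]⟩
  mul_mem' := by
    rintro U V ⟨c, p, hc, hU⟩ ⟨d, q, hd, hV⟩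
    obtain ⟨e, r, he, h⟩ := pauli_mul p q
    refine ⟨c * d * e, r, by rw [mul_pow, mul_pow, hc, hd, he]; simp, ?_⟩
    change U.1 * V.1 = _
    rw [hU, hV, Matrix.smul_mul, Matrix.mul_smul, h, smul_smul, smul_smul, mul_assoc]
  inv_mem' := by
    rintro U ⟨c, p, hc, hU⟩
    refine ⟨star c, p, by rw [← star_pow, hc, star_one], ?_⟩
    change U.1ᴴ = _
    rw [hU, Matrix.conjTranspose_smul, pauli_conjTranspose]

/-- The global phases `e^{iθ} I`. -/
def phases : Subgroup (unitaryGroup (Fin 2) ℂ) where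
  carrier := {U | ∃ c : ℂ, U.1 = c • (1 : Op (Fin 2))}
  one_mem' := ⟨1, by simp⟩
  mul_mem' := by
    rintro U V ⟨c, hU⟩ ⟨d, hV⟩
    refine ⟨c * d, ?_⟩
    change U.1 * V.1 = _
    rw [hU, hV, Matrix.smul_mul, Matrix.mul_smul, Matrix.one_mul, smul_smul]
  inv_mem' := by
    rintro U ⟨c, hU⟩
    refine ⟨star c, ?_⟩
    change U.1ᴴ = _
    rw [hU, Matrix.conjTranspose_smul, Matrix.conjTranspose_one]

/-- The single-qubit unitaries that normalize the Pauli group. -/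
def cliffordUnitaries : Subgroup (unitaryGroup (Fin 2) ℂ) :=
  Subgroup.normalizer (pauliGroup : Set (unitaryGroup (Fin 2) ℂ))

/-- The single-qubit Clifford group: the normalizer of the Pauli group, modulo global phases. -/
def Cl2 : Type := cliffordUnitaries ⧸ phases.subgroupOf cliffordUnitaries

instance : Nonempty Cl2 := ⟨QuotientGroup.mk 1⟩

theorem pauliGroup_finite : Finite pauliGroup := by
  have hfin : {c : ℂ | c ^ 4 = 1}.Finite := by
    refine (Polynomial.finite_setOfPred_isRoot (p := (Polynomial.X ^ 4 - 1 : Polynomial ℂ))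
      (Polynomial.X_pow_sub_C_ne_zero (by norm_num) (1 : ℂ))).subset ?_
    intro c hc
    simpa [Polynomial.IsRoot, sub_eq_zero] using hc
  have : Finite {c : ℂ | c ^ 4 = 1} := hfin
  choose c p hc hp using fun U : pauliGroup => U.2
  refine Finite.of_injective
    (fun U : pauliGroup => ((⟨c U, hc U⟩ : {c : ℂ | c ^ 4 = 1}), p U)) ?_
  intro U V h
  simp only [Prod.mk.injEq, Subtype.mk.injEq] at h
  exact Subtype.ext (Subtype.ext (by rw [hp U, hp V, h.1, h.2]))

/-- `pauli p` as an element of the Pauli group. -/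
def pauliElt (p : Fin 4) : pauliGroup :=
  ⟨⟨pauli p, by
    rw [mem_unitaryGroup_iff]
    change pauli p * (pauli p)ᴴ = 1
    rw [pauli_conjTranspose]
    fin_cases p <;> simp [pauli, Matrix.one_fin_two]⟩, 1, p, by simp, by simp⟩

/-- A `2 × 2` matrix that commutes with `X` and `Z` is scalar. -/
theorem scalar_of_commute (A : Op (Fin 2)) (hX : A * pauli 1 = pauli 1 * A)
    (hZ : A * pauli 3 = pauli 3 * A) : ∃ c : ℂ, A = c • (1 : Op (Fin 2)) := by
  have z1 := congrFun (congrFun hZ 0) 1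
  have z2 := congrFun (congrFun hZ 1) 0
  have x1 := congrFun (congrFun hX 0) 1
  simp [pauli, Matrix.mul_apply, Fin.sum_univ_two] at z1 z2 x1
  have h01 : A 0 1 = 0 := by linear_combination (-(1 : ℂ) / 2) * z1
  have h10 : A 1 0 = 0 := by linear_combination ((1 : ℂ) / 2) * z2
  refine ⟨A 0 0, ?_⟩
  ext i j
  fin_cases i <;> fin_cases j <;> simp [h01, h10, x1]

instance : Finite Cl2 := by
  have := pauliGroup_finite
  have key : ∀ g : cliffordUnitaries, ∀ p : Fin 4,
      g.1 * (pauliElt p).1 * g.1⁻¹ ∈ pauliGroup := fun g p =>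
    (Subgroup.mem_normalizer_iff.1 g.2 _).1 (pauliElt p).2
  refine Finite.of_injective (fun q : Cl2 =>
    ((⟨_, key (Quotient.out q) 1⟩ : pauliGroup), (⟨_, key (Quotient.out q) 3⟩ : pauliGroup))) ?_
  intro q q' h
  simp only [Prod.mk.injEq, Subtype.mk.injEq] at h
  have comm : ∀ {G : Type} [Group G] (a b x : G), a * x * a⁻¹ = b * x * b⁻¹ →
      (a⁻¹ * b) * x = x * (a⁻¹ * b) := by
    intro G _ a b x hx
    have : b * x = a * x * a⁻¹ * b := by rw [hx]; group
    rw [mul_assoc, this]; group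
  obtain ⟨c, hc⟩ := scalar_of_commute (((Quotient.out q).1⁻¹ * (Quotient.out q').1 :
      unitaryGroup (Fin 2) ℂ).1)
    (congrArg Subtype.val (comm _ _ _ h.1)) (congrArg Subtype.val (comm _ _ _ h.2))
  rw [← Quotient.out_eq q, ← Quotient.out_eq q']
  exact QuotientGroup.eq.2 (Subgroup.mem_subgroupOf.2 ⟨c, hc⟩)

instance : Fintype Cl2 := Fintype.ofFinite Cl2

/-- A representing unitary of a Clifford group element; its phase is immaterial since unitaries
only act by conjugation below. -/
def Cl2.rep (g : Cl2) : unitaryGroup (Fin 2) ℂ := (Quotient.out g).1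

theorem tensor_mul {n : ℕ} (A B : Fin n → Op (Fin 2)) :
    tensor A * tensor B = tensor (fun i => A i * B i) := by
  ext x y
  simp only [tensor, Matrix.mul_apply, ← Finset.prod_mul_distrib]
  rw [Finset.prod_univ_sum]
  simp [Fintype.piFinset_univ]

theorem tensor_one {n : ℕ} : tensor (fun _ : Fin n => (1 : Op (Fin 2))) = 1 := by
  ext x y
  simp only [tensor, Matrix.one_apply]
  by_cases h : x = y
  · simp [h]
  · obtain ⟨i, hi⟩ := Function.ne_iff.1 h
    rw [if_neg h]
    exact Finset.prod_eq_zero (Finset.mem_univ i) (if_neg hi)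

theorem tensor_conjTranspose {n : ℕ} (A : Fin n → Op (Fin 2)) :
    (tensor A)ᴴ = tensor (fun i => (A i)ᴴ) := by
  ext x y
  simp [tensor, Matrix.conjTranspose_apply]

/-- The local Clifford unitary `U = ⊗ᵢ Uᵢ`. -/
def localClifford {n : ℕ} (u : Fin n → Cl2) : unitaryGroup (Bits n) ℂ :=
  ⟨tensor (fun i => (u i).rep.1), by
    rw [mem_unitaryGroup_iff]
    change tensor _ * (tensor _)ᴴ = 1
    rw [tensor_conjTranspose, tensor_mul, ← tensor_one]
    congr 1
    funext i
    exact mem_unitaryGroup_iff.1 (u i).rep.2⟩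

/-- The `n`-qubit Pauli operators. -/
def pauliString {n : ℕ} (p : Fin n → Fin 4) : Op (Bits n) := tensor (fun i => pauli (p i))

/-- `z(p)ᵢ = 0` iff the `i`-th factor of `P_p` is the identity. -/
def support {n : ℕ} (p : Fin n → Fin 4) : Bits n := fun i => if p i = 0 then 0 else 1

/-- `Π_z = ⊗ᵢ Π_{zᵢ}`, the orthogonal projector onto the span of the Pauli operators whose
non-identity factors are exactly at the positions with `zᵢ = 1`:
`Π_z = ∑_{p : z(p) = z} |σ_p⟩⟩⟨⟨σ_p|` with `σ_p = 2^{-n/2} P_p`. -/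
def proj {n : ℕ} (z : Bits n) (A : Op (Bits n)) : Op (Bits n) :=
  ∑ p : Fin n → Fin 4, if support p = z then
    ((2 ^ n : ℂ)⁻¹ * hs (pauliString p) A) • pauliString p else 0

/-- `P_z = ⊗ᵢ Z^{zᵢ}`. -/
def zString {n : ℕ} (z : Bits n) : Op (Bits n) := pauliString (fun i => if z i = 0 then 0 else 3)

/-- The number of ones in `z`. -/
def weight {n : ℕ} (z : Bits n) : ℕ := (Finset.univ.filter (fun i => z i = 1)).card

/-! ### The protocol -/

/-- The record of one round: the sampled local Clifford element and the measured bit string. -/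
abbrev Round (n : ℕ) : Type := (Fin n → Cl2) × Bits n

instance : MeasurableSpace Cl2 := ⊤

instance : DiscreteMeasurableSpace Cl2 := ⟨fun _ => trivial⟩

/-- One round on the input state `ρ`: sample `U` uniformly from the local Clifford group, apply
the noisy gate `Λ ∘ 𝒰`, and measure in the computational basis. -/
def roundLaw {n : ℕ} (Λ : Channel (Bits n)) (ρ : State (Bits n)) : PMF (Round n) :=
  (PMF.uniformOfFintype (Fin n → Cl2)).bind fun u =>
    (Λ.apply (ρ.conj (localClifford u))).measure.map fun b => (u, b)

/-- The joint law of `K` groups of `N` independent rounds. -/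
def roundsLaw {n : ℕ} (Λ : Channel (Bits n)) (ρ : State (Bits n)) (N K : ℕ) :
    Measure (Fin K × Fin N → Round n) :=
  Measure.pi fun _ => (roundLaw Λ ρ).toMeasure

/-- The single-round estimator `⟨⟨b|𝒰|P_z⟩⟩` of the Pauli fidelity `f_z`. -/
def noiseEst {n : ℕ} (z : Bits n) (r : Round n) : ℝ :=
  (hs (ketbra r.2) ((localClifford r.1).1 * zString z * (localClifford r.1).1ᴴ)).re

/-- The median of `K` real numbers (the mean of the two middle ones if `K` is even). -/
def median {K : ℕ} (v : Fin K → ℝ) : ℝ :=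
  if h : 0 < K then
    (v (Tuple.sort v ⟨(K - 1) / 2, by omega⟩) + v (Tuple.sort v ⟨K / 2, by omega⟩)) / 2
  else 0

/-- The median of the means of `K` groups of `N` numbers. -/
def medianOfMeans {N K : ℕ} (v : Fin K × Fin N → ℝ) : ℝ :=
  median fun t : Fin K => (N : ℝ)⁻¹ * ∑ j : Fin N, v (t, j)

/-- The calibrated Pauli fidelity `f̂_z`. -/
def fHat {n N K : ℕ} (data : Fin K × Fin N → Round n) (z : Bits n) : ℝ :=
  medianOfMeans fun r => noiseEst z (data r)

/-- `ℳ̂⁻¹ = ∑_z f̂_z⁻¹ Π_z`. -/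
def invM {n : ℕ} (f : Bits n → ℝ) (A : Op (Bits n)) : Op (Bits n) :=
  ∑ z, ((f z)⁻¹ : ℂ) • proj z A

/-- The single-round estimator `ô = ⟨⟨O|ℳ̂⁻¹ 𝒰†|b⟩⟩` of the estimation procedure. -/
def oHat {n : ℕ} (f : Bits n → ℝ) (O : Op (Bits n)) (r : Round n) : ℝ :=
  (hs O (invM f ((localClifford r.1).1ᴴ * ketbra r.2 * (localClifford r.1).1))).re

/-- `𝔼(ô)` over one round of the estimation procedure on `ρ`, for given calibrated values `f`. -/
def expectedEstimate {n : ℕ} (Λ : Channel (Bits n)) (f : Bits n → ℝ) (O : Op (Bits n))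
    (ρ : State (Bits n)) : ℝ :=
  ∫ r, oHat f O r ∂(roundLaw Λ ρ).toMeasure

/-- Group size of the calibration, where `F` is the `Z`-basis average fidelity. -/
def groupSize (k : ℕ) (ε F : ℝ) : ℕ := ⌈34 * 3 ^ k / (ε ^ 2 * (2 * F - 1) ^ 2)⌉₊

/-- Number of groups of the calibration. -/
def groupCount (n k : ℕ) (δ : ℝ) : ℕ := ⌈2 * Real.log (2 * (n : ℝ) ^ k / δ)⌉₊

end RShadow

end

noncomputable section

namespace RShadow

/-! ### Hilbert–Schmidt inner product -/

section General

variable {ι : Type} [Fintype ι]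

/-! Averaging over the local Clifford group makes one noisy round diagonal in the Pauli basis. For a
Pauli string `P_p` with support `z`, the variable `⟨b|U P_p U†|b⟩` has mean `f_z Tr(P_p ρ)`, where
`f_z = 3^{-|z|} · 2⁻ⁿ Tr(P_z Λ(P_z))` depends on `p` only through its support
(`sum_outcomeProb_mul_conj_pauliString`). Calibration uses this identity for `P_z`, and estimation
uses it for every Pauli component of `O`.

Consequently `𝔼(ô) - Tr(Oρ) = ∑_p 2⁻ⁿ (f_z / f̂_z - 1) Tr(O P_p) Tr(P_p ρ)`. For a `k`-local `O` at
most `4^k` terms survive, and Cauchy–Schwarz with Parseval bounds the sum by `2^k ‖O‖_∞` times the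
largest relative error (`abs_expectedEstimate_sub_le`).

It remains to control the relative error for `|z| ≤ k`. The square of the calibration estimator does
not depend on the outcome `b`, so its second moment is exactly `3^{-|z|}` for any noise and any
state (`integral_noiseEst_sq`). On the other hand `f_z ≥ 3^{-|z|}(2F_Z - 1)`
(`diagFraction_mul_le_pauliFidelity`). Chebyshev's inequality at tolerance `ε f_z` therefore needs a
group size of order `3^k ε⁻² (2F_Z - 1)⁻²`. The median over groups makes the failure probability
exponentially small in `K`, and a union bound covers the at most `2n^k` relevant `z`. A faulty
product calibration state only multiplies the mean by a factor in `[1 - 2kξ, 1]`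
(`re_hs_zString_product_mem`). -/

theorem hs_eq_sum (A B : Op ι) : hs A B = ∑ x, ∑ y, star (A x y) * B x y := by
  simp only [hs, Matrix.trace, Matrix.diag, Matrix.mul_apply, Matrix.conjTranspose_apply]
  exact Finset.sum_comm

theorem hs_ketbra [DecidableEq ι] (b : ι) (A : Op ι) : hs (ketbra b) A = A b b := by
  simp [hs, ketbra, Matrix.conjTranspose_single, Matrix.trace_single_mul]

theorem hs_conj_ketbra [DecidableEq ι] (U A : Op ι) (b : ι) :
    hs A (Uᴴ * ketbra b * U) = (U * Aᴴ * Uᴴ) b b := by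
  have h : hs A (Uᴴ * ketbra b * U) = (ketbra b * (U * Aᴴ * Uᴴ)).trace := by
    rw [hs, ← Matrix.mul_assoc, ← Matrix.mul_assoc, Matrix.trace_mul_comm, ← Matrix.mul_assoc,
      Matrix.trace_mul_comm]
    simp only [Matrix.mul_assoc]
  rw [h, ketbra, Matrix.trace_single_mul]
  simp

/-- A family with the completeness relation of an orthogonal basis expands every operator. -/
theorem sum_hs_smul_of_complete [DecidableEq ι] {κ : Type} [Fintype κ] (P : κ → Op ι) (c : ℂ)
    (hP : ∀ a b x y, ∑ r, star (P r a b) * P r x y = if a = x ∧ b = y then c else 0) (A : Op ι) :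
    ∑ r, hs (P r) A • P r = c • A := by
  ext x y
  simp only [Matrix.sum_apply, Matrix.smul_apply, hs_eq_sum, smul_eq_mul, Finset.sum_mul]
  calc _ = ∑ a, ∑ b, A a b * ∑ r, star (P r a b) * P r x y := by
        rw [Finset.sum_comm]
        refine Finset.sum_congr rfl fun a _ => ?_
        rw [Finset.sum_comm]
        refine Finset.sum_congr rfl fun b _ => ?_
        rw [Finset.mul_sum]
        exact Finset.sum_congr rfl fun r _ => by ring
    _ = c * A x y := by
        simp only [hP, ite_and, mul_ite, mul_zero, Finset.sum_ite_eq', Finset.mem_univ, if_true,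
          Finset.sum_ite_irrel, Finset.sum_const_zero]
        rw [mul_comm]

end General

/-! ### The single-qubit Clifford twirl -/

theorem pauli_completeness (a b x y : Fin 2) :
    ∑ r, star (pauli r a b) * pauli r x y = if a = x ∧ b = y then 2 else 0 := by
  fin_cases a <;> fin_cases b <;> fin_cases x <;> fin_cases y <;>
    simp [pauli, Fin.sum_univ_four] <;> norm_num

theorem sum_hs_smul_pauli (A : Op (Fin 2)) : ∑ r, hs (pauli r) A • pauli r = (2 : ℂ) • A :=
  sum_hs_smul_of_complete pauli 2 pauli_completeness A

/-- Expand `g†|b⟩⟨b|g` in the Pauli basis and conjugate back by `g`. This fixes the sum of the four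
diagonal Pauli twirls without enumerating the Clifford group. -/
theorem sum_conj_pauli (g : unitaryGroup (Fin 2) ℂ) (b : Fin 2) :
    ∑ r, (g.1 * pauli r * g.1ᴴ) b b • (g.1 * pauli r * g.1ᴴ) = (2 : ℂ) • ketbra b := by
  have h : g.1 * g.1ᴴ = 1 := mem_unitaryGroup_iff.1 g.2
  calc _ = g.1 * (∑ r, hs (pauli r) (g.1ᴴ * ketbra b * g.1) • pauli r) * g.1ᴴ := by
        simp only [hs_conj_ketbra, pauli_conjTranspose, Matrix.mul_sum, Matrix.sum_mul,
          Matrix.mul_smul, Matrix.smul_mul]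
    _ = (2 : ℂ) • ((g.1 * g.1ᴴ) * ketbra b * (g.1 * g.1ᴴ)) := by
        rw [sum_hs_smul_pauli]
        simp only [Matrix.mul_assoc, Matrix.mul_smul, Matrix.smul_mul]
    _ = _ := by rw [h, Matrix.one_mul, Matrix.mul_one]

theorem conj_mul_phase (U V : unitaryGroup (Fin 2) ℂ) (hV : V ∈ phases) (A : Op (Fin 2)) :
    (U * V).1 * A * (U * V).1ᴴ = U.1 * A * U.1ᴴ := by
  obtain ⟨c, hc⟩ := hV
  have h1 : V.1 * V.1ᴴ = 1 := mem_unitaryGroup_iff.1 V.2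
  have h2 : V.1 * A = A * V.1 := by rw [hc]; simp
  change (U.1 * V.1) * A * (U.1 * V.1)ᴴ = _
  rw [Matrix.conjTranspose_mul, Matrix.mul_assoc U.1, h2]
  simp only [Matrix.mul_assoc]
  rw [← Matrix.mul_assoc V.1, h1, Matrix.one_mul]

instance phases_normal : (phases.subgroupOf cliffordUnitaries).Normal := by
  constructor
  rintro V hV U
  have hV' : (V : unitaryGroup (Fin 2) ℂ) ∈ phases := hV
  rw [Subgroup.mem_subgroupOf]
  obtain ⟨c, hc⟩ := hV'
  refine ⟨c, ?_⟩
  have h : U.1.1 * U.1.1ᴴ = 1 := mem_unitaryGroup_iff.1 U.1.2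
  change U.1.1 * V.1.1 * U.1.1ᴴ = _
  rw [hc, Matrix.mul_smul, Matrix.smul_mul, Matrix.mul_one, h]

/-- Right translation permutes the quotient group, and the chosen representative of a product
differs from the product of representatives by a phase, which `F` does not see. -/
theorem sum_rep_mul {E : Type*} [AddCommMonoid E] (F : unitaryGroup (Fin 2) ℂ → E)
    (hF : ∀ U V, V ∈ phases → F (U * V) = F U) (h : cliffordUnitaries) :
    ∑ g : Cl2, F (g.rep * h.1) = ∑ g : Cl2, F g.rep := by
  let e : Cl2 ≃ Cl2 := Equiv.mulRight (G := cliffordUnitaries ⧸ phases.subgroupOf cliffordUnitaries)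
    (QuotientGroup.mk h)
  refine Fintype.sum_equiv e _ _ fun g => ?_
  have hq : (QuotientGroup.mk (Quotient.out g * h) :
      cliffordUnitaries ⧸ phases.subgroupOf cliffordUnitaries) =
      QuotientGroup.mk (Quotient.out (e g)) := by
    have h1 : (QuotientGroup.mk (Quotient.out (e g)) :
      cliffordUnitaries ⧸ phases.subgroupOf cliffordUnitaries) = e g := Quotient.out_eq (e g)
    have h2 : (QuotientGroup.mk (Quotient.out g) :
      cliffordUnitaries ⧸ phases.subgroupOf cliffordUnitaries) = g := Quotient.out_eq g
    rw [h1, QuotientGroup.mk_mul, h2]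
    rfl
  have hm := Subgroup.mem_subgroupOf.1 (QuotientGroup.eq.1 hq)
  have := hF (g.rep * h.1) _ hm
  rw [← this]
  congr 1
  change _ = (Quotient.out (e g)).1
  simp only [Cl2.rep, Subgroup.coe_mul, Subgroup.coe_inv]
  group

/-- The unnormalized average of `(gPg†)_{bb} gQg†` over the single-qubit Clifford group. -/
def twirl (b : Fin 2) (P Q : Op (Fin 2)) : Op (Fin 2) :=
  ∑ g : Cl2, (g.rep.1 * P * g.rep.1ᴴ) b b • (g.rep.1 * Q * g.rep.1ᴴ)

theorem twirl_conj (b : Fin 2) (P Q : Op (Fin 2)) (h : cliffordUnitaries) :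
    twirl b (h.1.1 * P * h.1.1ᴴ) (h.1.1 * Q * h.1.1ᴴ) = twirl b P Q := by
  have := sum_rep_mul (fun U => (U.1 * P * U.1ᴴ) b b • (U.1 * Q * U.1ᴴ))
    (fun U V hV => by simp only [conj_mul_phase U V hV]) h
  rw [twirl, twirl, ← this]
  refine Finset.sum_congr rfl fun g _ => ?_
  change _ = ((g.rep.1 * h.1.1) * P * (g.rep.1 * h.1.1)ᴴ) b b •
    ((g.rep.1 * h.1.1) * Q * (g.rep.1 * h.1.1)ᴴ)
  simp only [Matrix.conjTranspose_mul, Matrix.mul_assoc]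

/-! ### Pauli, phase and Hadamard gates as Clifford elements, and the values of the twirl -/

theorem pauliElt_mem_cliffordUnitaries (p : Fin 4) : (pauliElt p).1 ∈ cliffordUnitaries :=
  Subgroup.le_normalizer (pauliElt p).2

/-- The phase gate. -/
def phaseGate : unitaryGroup (Fin 2) ℂ :=
  ⟨!![1, 0; 0, Complex.I], by
    rw [mem_unitaryGroup_iff]
    ext i j
    fin_cases i <;> fin_cases j <;>
      simp [Matrix.mul_apply, Matrix.star_eq_conjTranspose, Fin.sum_univ_two]⟩

/-- The unitary `(X + Z) / √2`. -/
def hadamardGate : unitaryGroup (Fin 2) ℂ :=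
  ⟨((√2 : ℝ) : ℂ)⁻¹ • !![1, 1; 1, -1], by
    have h : ((√2 : ℝ) : ℂ)⁻¹ * ((√2 : ℝ) : ℂ)⁻¹ = 1 / 2 := by
      rw [← mul_inv, ← Complex.ofReal_mul, Real.mul_self_sqrt (by norm_num)]; norm_num
    rw [mem_unitaryGroup_iff, Matrix.star_eq_conjTranspose, Matrix.conjTranspose_smul,
      Matrix.smul_mul, Matrix.mul_smul, smul_smul]
    have h' : star ((√2 : ℝ) : ℂ)⁻¹ = ((√2 : ℝ) : ℂ)⁻¹ := by
      rw [star_inv₀]; congr 1; exact Complex.conj_ofReal _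
    rw [h', h]
    have h2 : (!![1, 1; 1, -1] : Op (Fin 2))ᴴ = !![1, 1; 1, -1] := by
      ext i j; fin_cases i <;> fin_cases j <;> simp
    rw [h2]
    ext i j
    fin_cases i <;> fin_cases j <;> simp <;> norm_num⟩

/-- Being in the normalizer is an equivalence, but one direction suffices: conjugation is an
injective self-map of the finite Pauli group, hence surjective. -/
theorem mem_cliffordUnitaries_of_conj (U : unitaryGroup (Fin 2) ℂ)
    (h : ∀ p : Fin 4, ∃ (c : ℂ) (r : Fin 4), c ^ 4 = 1 ∧ U.1 * pauli p * U.1ᴴ = c • pauli r) :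
    U ∈ cliffordUnitaries := by
  have := pauliGroup_finite
  refine Subgroup.mem_normalizer_iff.2 ?_
  have key : ∀ V ∈ pauliGroup, U * V * U⁻¹ ∈ pauliGroup := by
    rintro V ⟨c, p, hc, hV⟩
    obtain ⟨d, r, hd, hr⟩ := h p
    refine ⟨c * d, r, by rw [mul_pow, hc, hd, one_mul], ?_⟩
    change U.1 * V.1 * U.1ᴴ = _
    rw [hV, Matrix.mul_smul, Matrix.smul_mul, hr, smul_smul]
  intro V
  refine ⟨key V, fun hV => ?_⟩
  let φ : pauliGroup → pauliGroup := fun W => ⟨U * W.1 * U⁻¹, key _ W.2⟩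
  have hφ : Function.Injective φ := by
    intro W W' hW
    have : U * W.1 * U⁻¹ = U * W'.1 * U⁻¹ := congrArg Subtype.val hW
    exact Subtype.ext (by simpa using this)
  obtain ⟨W, hW⟩ := (Finite.injective_iff_surjective.1 hφ) ⟨_, hV⟩
  have : U * W.1 * U⁻¹ = U * V * U⁻¹ := congrArg Subtype.val hW
  have hWV : W.1 = V := by simpa using this
  exact hWV ▸ W.2

theorem phaseGate_conj_pauli :
    phaseGate.1 * pauli 1 * phaseGate.1ᴴ = pauli 2 ∧
    phaseGate.1 * pauli 2 * phaseGate.1ᴴ = (-1 : ℂ) • pauli 1 ∧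
    phaseGate.1 * pauli 3 * phaseGate.1ᴴ = pauli 3 := by
  refine ⟨?_, ?_, ?_⟩ <;> ext i j <;> fin_cases i <;> fin_cases j <;>
    simp [phaseGate, pauli, Matrix.mul_apply, Fin.sum_univ_two]

theorem hadamardGate_conj (A : Op (Fin 2)) : hadamardGate.1 * A * hadamardGate.1ᴴ =
    (1 / 2 : ℂ) • (!![1, 1; 1, -1] * A * !![1, 1; 1, -1]) := by
  have h : ((√2 : ℝ) : ℂ)⁻¹ * ((√2 : ℝ) : ℂ)⁻¹ = 1 / 2 := by
    rw [← mul_inv, ← Complex.ofReal_mul, Real.mul_self_sqrt (by norm_num)]; norm_num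
  have h' : star ((√2 : ℝ) : ℂ)⁻¹ = ((√2 : ℝ) : ℂ)⁻¹ := by
    rw [star_inv₀]; congr 1; exact Complex.conj_ofReal _
  have h2 : (!![1, 1; 1, -1] : Op (Fin 2))ᴴ = !![1, 1; 1, -1] := by
    ext i j; fin_cases i <;> fin_cases j <;> simp
  simp only [hadamardGate, Matrix.conjTranspose_smul, Matrix.smul_mul, Matrix.mul_smul, smul_smul,
    h', h, h2]

theorem hadamardGate_conj_pauli :
    hadamardGate.1 * pauli 1 * hadamardGate.1ᴴ = pauli 3 ∧
    hadamardGate.1 * pauli 2 * hadamardGate.1ᴴ = (-1 : ℂ) • pauli 2 ∧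
    hadamardGate.1 * pauli 3 * hadamardGate.1ᴴ = pauli 1 := by
  simp only [hadamardGate_conj]
  refine ⟨?_, ?_, ?_⟩ <;> ext i j <;> fin_cases i <;> fin_cases j <;>
    simp [pauli] <;> ring

theorem conj_pauli_zero (U : unitaryGroup (Fin 2) ℂ) : U.1 * pauli 0 * U.1ᴴ = pauli 0 := by
  have h : U.1 * U.1ᴴ = 1 := mem_unitaryGroup_iff.1 U.2
  simpa [pauli] using h

theorem phaseGate_mem : phaseGate ∈ cliffordUnitaries := by
  obtain ⟨h1, h2, h3⟩ := phaseGate_conj_pauli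
  refine mem_cliffordUnitaries_of_conj _ fun p => ?_
  fin_cases p
  · exact ⟨1, 0, by norm_num, by rw [one_smul]; exact conj_pauli_zero _⟩
  · exact ⟨1, 2, by norm_num, by rw [one_smul]; exact h1⟩
  · exact ⟨-1, 1, by norm_num, h2⟩
  · exact ⟨1, 3, by norm_num, by rw [one_smul]; exact h3⟩

theorem hadamardGate_mem : hadamardGate ∈ cliffordUnitaries := by
  obtain ⟨h1, h2, h3⟩ := hadamardGate_conj_pauli
  refine mem_cliffordUnitaries_of_conj _ fun p => ?_
  fin_cases p
  · exact ⟨1, 0, by norm_num, by rw [one_smul]; exact conj_pauli_zero _⟩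
  · exact ⟨1, 3, by norm_num, by rw [one_smul]; exact h1⟩
  · exact ⟨-1, 2, by norm_num, h2⟩
  · exact ⟨1, 1, by norm_num, by rw [one_smul]; exact h3⟩

theorem twirl_smul_left (b : Fin 2) (c : ℂ) (P Q : Op (Fin 2)) :
    twirl b (c • P) Q = c • twirl b P Q := by
  simp [twirl, Finset.smul_sum, smul_smul]

theorem twirl_smul_right (b : Fin 2) (c : ℂ) (P Q : Op (Fin 2)) :
    twirl b P (c • Q) = c • twirl b P Q := by
  simp [twirl, Finset.smul_sum, smul_smul, mul_comm]

/-- Distinct Pauli matrices are told apart by the signs that conjugation with a third one gives. -/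
theorem exists_pauli_conj_sign {p q : Fin 4} (h : p ≠ q) : ∃ (r : Fin 4) (s t : ℂ), s * t = -1 ∧
    pauli r * pauli p * (pauli r)ᴴ = s • pauli p ∧
    pauli r * pauli q * (pauli r)ᴴ = t • pauli q := by
  have key : ∀ r p : Fin 4, pauli r * pauli p * (pauli r)ᴴ =
      (if r = 0 ∨ p = 0 ∨ r = p then (1 : ℂ) else -1) • pauli p := by
    intro r p
    rw [pauli_conjTranspose]
    fin_cases r <;> fin_cases p <;> simp [pauli] <;> simp [Matrix.one_fin_two]
  -- The disjunctions say when two Pauli matrices commute, so `r` commutes with exactly one of `p`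
  -- and `q`.
  have hr : ∃ r : Fin 4, ¬((r = 0 ∨ p = 0 ∨ r = p) ↔ (r = 0 ∨ q = 0 ∨ r = q)) := by
    revert p q; decide
  obtain ⟨r, hr⟩ := hr
  refine ⟨r, _, _, ?_, key r p, key r q⟩
  split_ifs <;> first | (exfalso; tauto) | norm_num

/-- Translation by a Pauli that commutes with one of the two and anticommutes with the other leaves
the twirl unchanged but flips its sign. -/
theorem twirl_pauli_of_ne (b : Fin 2) {p q : Fin 4} (h : p ≠ q) :
    twirl b (pauli p) (pauli q) = 0 := by
  obtain ⟨r, s, t, hst, hp, hq⟩ := exists_pauli_conj_sign h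
  have := twirl_conj b (pauli p) (pauli q) ⟨_, pauliElt_mem_cliffordUnitaries r⟩
  change twirl b (pauli r * pauli p * (pauli r)ᴴ) (pauli r * pauli q * (pauli r)ᴴ) = _ at this
  rw [hp, hq, twirl_smul_left, twirl_smul_right, smul_smul, hst, neg_one_smul] at this
  ext i j
  exact self_eq_neg.1 (congrFun (congrFun this i) j).symm

theorem twirl_pauli_zero (b : Fin 2) :
    twirl b (pauli 0) (pauli 0) = (Fintype.card Cl2 : ℂ) • pauli 0 := by
  simp only [twirl, conj_pauli_zero, Finset.sum_const, Finset.card_univ]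
  rw [← Nat.cast_smul_eq_nsmul ℂ]
  simp [pauli]

theorem ketbra_eq_pauli (b : Fin 2) :
    (2 : ℂ) • ketbra b = pauli 0 + pauli 3 b b • pauli 3 := by
  ext i j
  fin_cases b <;> fin_cases i <;> fin_cases j <;> simp [ketbra, pauli] <;> norm_num

/-- The phase and Hadamard gates carry `X` to `Y` and to `Z`, so the three non-identity twirls
coincide. Their sum is known from `sum_conj_pauli`, so each is a third of it; this is the origin of
every factor `1/3`. -/
theorem twirl_pauli_self (b : Fin 2) {p : Fin 4} (hp : p ≠ 0) :
    twirl b (pauli p) (pauli p) =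
      ((Fintype.card Cl2 : ℂ) * (1 / 3) * pauli 3 b b) • pauli 3 := by
  have hS := twirl_conj b (pauli 1) (pauli 1) ⟨_, phaseGate_mem⟩
  have hH := twirl_conj b (pauli 1) (pauli 1) ⟨_, hadamardGate_mem⟩
  simp only [phaseGate_conj_pauli.1] at hS
  simp only [hadamardGate_conj_pauli.1] at hH
  have hsum : ∑ r, twirl b (pauli r) (pauli r) =
      (Fintype.card Cl2 : ℂ) • (pauli 0 + pauli 3 b b • pauli 3) := by
    simp only [twirl]
    rw [Finset.sum_comm]
    simp only [sum_conj_pauli, ketbra_eq_pauli, Finset.sum_const, Finset.card_univ]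
    rw [← Nat.cast_smul_eq_nsmul ℂ]
  rw [Fin.sum_univ_four, twirl_pauli_zero, hS, hH, smul_add, add_assoc, add_assoc,
    add_right_inj] at hsum
  have h1 : twirl b (pauli 1) (pauli 1) =
      ((Fintype.card Cl2 : ℂ) * (1 / 3) * pauli 3 b b) • pauli 3 := by
    have : (3 : ℂ) • twirl b (pauli 1) (pauli 1) =
        (Fintype.card Cl2 : ℂ) • pauli 3 b b • pauli 3 := by
      rw [← hsum]; module
    calc _ = (1 / 3 : ℂ) • (3 : ℂ) • twirl b (pauli 1) (pauli 1) := by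
          rw [smul_smul]; norm_num
      _ = _ := by rw [this]; module
  fin_cases p
  · exact absurd rfl hp
  · exact h1
  · exact hS.trans h1
  · exact hH.trans h1

/-! ### The local Clifford twirl -/

section Twirl

variable {n : ℕ}

theorem tensor_diag (A : Fin n → Op (Fin 2)) (b : Bits n) :
    tensor A b b = ∏ i, A i (b i) (b i) := rfl

theorem trace_tensor (A : Fin n → Op (Fin 2)) : (tensor A).trace = ∏ i, (A i).trace := by
  simp only [Matrix.trace, Matrix.diag, tensor]
  rw [Finset.prod_univ_sum]
  simp [Fintype.piFinset_univ]

theorem hs_tensor (A B : Fin n → Op (Fin 2)) :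
    hs (tensor A) (tensor B) = ∏ i, hs (A i) (B i) := by
  simp only [hs, tensor_conjTranspose, tensor_mul, trace_tensor]

theorem pauliString_conjTranspose (p : Fin n → Fin 4) : (pauliString p)ᴴ = pauliString p := by
  simp only [pauliString, tensor_conjTranspose, pauli_conjTranspose]

theorem localClifford_conj_tensor (u : Fin n → Cl2) (A : Fin n → Op (Fin 2)) :
    (localClifford u).1 * tensor A * (localClifford u).1ᴴ =
      tensor (fun i => (u i).rep.1 * A i * (u i).rep.1ᴴ) := by
  simp only [localClifford, tensor_conjTranspose, tensor_mul]

theorem pauliString_completeness (a b x y : Bits n) :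
    ∑ r, star (pauliString r a b) * pauliString r x y = if a = x ∧ b = y then 2 ^ n else 0 := by
  have h : ∑ r, star (pauliString r a b) * pauliString r x y =
      ∏ i, ∑ r, star (pauli r (a i) (b i)) * pauli r (x i) (y i) := by
    rw [Finset.prod_univ_sum]
    simp [Fintype.piFinset_univ, pauliString, tensor, Finset.prod_mul_distrib]
  rw [h]
  simp only [pauli_completeness]
  split_ifs with hab
  · simp [hab.1, hab.2]
  · have : ∃ i, ¬(a i = x i ∧ b i = y i) := by
      by_contra! hc
      exact hab ⟨funext fun i => (hc i).1, funext fun i => (hc i).2⟩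
    obtain ⟨i, hi⟩ := this
    exact Finset.prod_eq_zero (Finset.mem_univ i) (if_neg hi)

theorem sum_hs_smul_pauliString (A : Op (Bits n)) :
    ∑ r, hs (pauliString r) A • pauliString r = (2 ^ n : ℂ) • A :=
  sum_hs_smul_of_complete pauliString _ pauliString_completeness A

theorem pauliString_expansion (A : Op (Bits n)) :
    A = ∑ r, ((2 ^ n : ℂ)⁻¹ * hs (pauliString r) A) • pauliString r := by
  simp only [mul_smul, ← Finset.smul_sum, sum_hs_smul_pauliString]
  rw [smul_smul, inv_mul_cancel₀ (by positivity), one_smul]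

/-- The fraction `3^{-|z|}` of the local Clifford group that maps `P_z` to a diagonal operator. -/
def diagFraction (z : Bits n) : ℝ := (1 / 3) ^ weight z

theorem diagFraction_pos (z : Bits n) : 0 < diagFraction z := by
  unfold diagFraction; positivity

theorem prod_ite_eq_diagFraction (z : Bits n) :
    ∏ i, (if z i = 0 then (1 : ℝ) else 1 / 3) = diagFraction z := by
  rw [Finset.prod_ite, Finset.prod_const_one, one_mul, Finset.prod_const, diagFraction, weight]
  congr 2
  ext i
  simp only [Finset.mem_filter, Finset.mem_univ, true_and]
  omega

theorem sum_localClifford_prod {R : Type*} [CommSemiring R] (F : Fin n → Cl2 → R) :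
    ∑ u : Fin n → Cl2, ∏ i, F i (u i) = ∏ i, ∑ g, F i g := by
  rw [Finset.prod_univ_sum, Fintype.piFinset_univ]

/-- The single-qubit twirl in entries. -/
theorem sum_rep_conj_pauli (p q : Fin 4) (b x y : Fin 2) :
    ∑ g : Cl2, (g.rep.1 * pauli p * g.rep.1ᴴ) b b * (g.rep.1 * pauli q * g.rep.1ᴴ) x y =
      if p = q then (Fintype.card Cl2 : ℂ) * ((if p = 0 then 1 else 1 / 3 : ℝ) : ℂ) *
        (pauli (if p = 0 then 0 else 3) b b * pauli (if p = 0 then 0 else 3) x y) else 0 := by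
  have h : ∑ g : Cl2, (g.rep.1 * pauli p * g.rep.1ᴴ) b b * (g.rep.1 * pauli q * g.rep.1ᴴ) x y =
      twirl b (pauli p) (pauli q) x y := by
    simp [twirl, Matrix.sum_apply]
  rw [h]
  split_ifs with hpq hp
  · subst hpq hp
    rw [twirl_pauli_zero]
    simp [pauli]
  · subst hpq
    rw [twirl_pauli_self b hp]
    simp [mul_assoc]
  · rw [twirl_pauli_of_ne b hpq]
    rfl

theorem zString_support (p : Fin n → Fin 4) :
    zString (support p) = tensor (fun i => pauli (if p i = 0 then 0 else 3)) := by
  simp only [zString, pauliString, support]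
  congr 1
  funext i
  by_cases h : p i = 0 <;> simp [h]

theorem support_ite (z : Bits n) : support (fun i => if z i = 0 then 0 else 3) = z := by
  funext i
  by_cases h : z i = 0
  · simp [support, h]
  · simp only [support, h]
    simp
    omega

/-- Entrywise the average factors over the qubits, so one mismatched position annihilates it, and
each non-identity position contributes `1/3`. -/
theorem sum_localClifford_conj_pauliString (p q : Fin n → Fin 4) (b : Bits n) :
    ∑ u : Fin n → Cl2, ((localClifford u).1 * pauliString p * (localClifford u).1ᴴ) b b •
        ((localClifford u).1 * pauliString q * (localClifford u).1ᴴ) =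
      if p = q then (Fintype.card (Fin n → Cl2) * diagFraction (support p) *
        zString (support p) b b : ℂ) • zString (support p) else 0 := by
  ext x y
  simp only [pauliString, localClifford_conj_tensor, Matrix.sum_apply, Matrix.smul_apply,
    smul_eq_mul, tensor, ← Finset.prod_mul_distrib]
  rw [sum_localClifford_prod (fun i g => (g.rep.1 * pauli (p i) * g.rep.1ᴴ) (b i) (b i) *
    (g.rep.1 * pauli (q i) * g.rep.1ᴴ) (x i) (y i))]
  simp only [sum_rep_conj_pauli]
  split_ifs with hpq
  · subst hpq
    simp only [if_true, Finset.prod_mul_distrib, Matrix.smul_apply, smul_eq_mul]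
    rw [zString_support, tensor, tensor, ← prod_ite_eq_diagFraction, Complex.ofReal_prod]
    have hs : ∀ i, support p i = 0 ↔ p i = 0 := fun i => by
      by_cases h : p i = 0 <;> simp [support, h]
    simp only [hs, Finset.prod_const, Finset.card_univ, Fintype.card_pi]
    push_cast
    ring
  · obtain ⟨i, hi⟩ := Function.ne_iff.1 hpq
    exact Finset.prod_eq_zero (Finset.mem_univ i) (if_neg hi)

theorem sum_localClifford_conj (p : Fin n → Fin 4) (A : Op (Bits n)) (b : Bits n) :
    ∑ u : Fin n → Cl2, ((localClifford u).1 * pauliString p * (localClifford u).1ᴴ) b b •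
        ((localClifford u).1 * A * (localClifford u).1ᴴ) =
      (Fintype.card (Fin n → Cl2) * diagFraction (support p) * zString (support p) b b *
        ((2 ^ n)⁻¹ * hs (pauliString p) A) : ℂ) • zString (support p) := by
  conv_lhs => rw [pauliString_expansion A]
  simp only [Matrix.mul_sum, Matrix.sum_mul, Matrix.mul_smul, Matrix.smul_mul, Finset.smul_sum]
  rw [Finset.sum_comm]
  simp_rw [smul_comm _ ((2 ^ n : ℂ)⁻¹ * _), ← Finset.smul_sum,
    sum_localClifford_conj_pauliString]
  rw [Finset.sum_eq_single p]
  · rw [if_pos rfl, smul_smul]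
    congr 1
    ring
  · intro q _ hq
    rw [if_neg hq.symm, smul_zero]
  · simp

end Twirl

/-! ### Pauli fidelities -/

section Fidelity

variable {n : ℕ}

/-- `2⁻ⁿ Tr(P_z Λ(P_z))`. -/
def zCorrelation (Λ : Channel (Bits n)) (z : Bits n) : ℝ :=
  (2 ^ n)⁻¹ * ∑ b, (zString z b b * Λ.map (zString z) b b).re

/-- The Pauli fidelity `f_z` of the twirled channel. -/
def pauliFidelity (Λ : Channel (Bits n)) (z : Bits n) : ℝ := diagFraction z * zCorrelation Λ z

/-- The sign `(-1)^{z · b}`. -/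
def zSign (z b : Bits n) : ℝ := ∏ i, if z i = 0 ∨ b i = 0 then 1 else -1

theorem zSign_mul_self (z b : Bits n) : zSign z b * zSign z b = 1 := by
  rw [zSign, ← Finset.prod_mul_distrib]
  refine Finset.prod_eq_one fun i _ => ?_
  split_ifs <;> norm_num

theorem abs_zSign (z b : Bits n) : |zSign z b| = 1 := by
  rcases mul_self_eq_one_iff.1 (zSign_mul_self z b) with h | h <;> simp [h]

theorem zString_apply (z x y : Bits n) :
    zString z x y = if x = y then (zSign z x : ℂ) else 0 := by
  have key : ∀ i, pauli (if z i = 0 then 0 else 3) (x i) (y i) =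
      if x i = y i then ((if z i = 0 ∨ x i = 0 then 1 else -1 : ℝ) : ℂ) else 0 := by
    intro i
    generalize z i = a, x i = b, y i = c
    fin_cases a <;> fin_cases b <;> fin_cases c <;> simp [pauli]
  simp only [zString, pauliString, tensor, key, zSign]
  split_ifs with h
  · subst h
    simp
  · obtain ⟨i, hi⟩ := Function.ne_iff.1 h
    exact Finset.prod_eq_zero (Finset.mem_univ i) (if_neg hi)

theorem zString_eq_sum (z : Bits n) : zString z = ∑ b, (zSign z b : ℂ) • ketbra b := by
  ext x y
  rw [zString_apply]
  simp only [Matrix.sum_apply, Matrix.smul_apply, ketbra, Matrix.single_apply, smul_eq_mul,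
    mul_ite, mul_one, mul_zero, ite_and]
  simp

theorem ketbra_posSemidef {ι : Type} [Fintype ι] [DecidableEq ι] (b : ι) :
    (ketbra b : Op ι).PosSemidef := by
  have := Matrix.posSemidef_conjTranspose_mul_self (ketbra b : Op ι)
  simpa [ketbra, Matrix.conjTranspose_single] using this

/-- The transition probability `⟨b|Λ(|b'⟩⟨b'|)|b⟩`. -/
def transition (Λ : Channel (Bits n)) (b' b : Bits n) : ℝ := (Λ.map (ketbra b') b b).re

theorem transition_nonneg (Λ : Channel (Bits n)) (b' b : Bits n) : 0 ≤ transition Λ b' b :=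
  (Complex.nonneg_iff.1 (Λ.positive (ketbra_posSemidef b')).diag_nonneg).1

theorem sum_transition (Λ : Channel (Bits n)) (b' : Bits n) : ∑ b, transition Λ b' b = 1 := by
  have h := congrArg Complex.re (Λ.tracePreserving (ketbra b'))
  simpa [Matrix.trace, transition, ketbra, Matrix.single_apply] using h

theorem zFidelity_eq (Λ : Channel (Bits n)) :
    zFidelity Λ = (2 ^ n)⁻¹ * ∑ b, transition Λ b b := by
  simp only [zFidelity, hs_ketbra, transition]

theorem zFidelity_le_one (Λ : Channel (Bits n)) : zFidelity Λ ≤ 1 := by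
  rw [zFidelity_eq, inv_mul_le_one₀ (by positivity)]
  calc _ ≤ ∑ b : Bits n, (1 : ℝ) := Finset.sum_le_sum fun b _ => by
        rw [← sum_transition Λ b]
        exact Finset.single_le_sum (f := fun b' => transition Λ b b')
          (fun b' _ => transition_nonneg Λ b b') (Finset.mem_univ b)
    _ = 2 ^ n := by simp

theorem zCorrelation_eq (Λ : Channel (Bits n)) (z : Bits n) :
    zCorrelation Λ z = (2 ^ n)⁻¹ * ∑ b, ∑ b', zSign z b * zSign z b' * transition Λ b' b := by
  rw [zCorrelation]
  congr 1
  refine Finset.sum_congr rfl fun b _ => ?_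
  conv_lhs => rw [zString_apply, if_pos rfl, zString_eq_sum]
  rw [map_sum, Matrix.sum_apply, Complex.re_ofReal_mul, Complex.re_sum, Finset.mul_sum]
  refine Finset.sum_congr rfl fun b' _ => ?_
  rw [map_smul, Matrix.smul_apply, smul_eq_mul, Complex.re_ofReal_mul, transition, mul_assoc]

/-- The correlation is an average of transition probabilities with signs: the diagonal ones, of
total weight `F`, have sign `+1`, and the rest, of weight `1 - F`, have sign at least `-1`. -/
theorem two_mul_zFidelity_sub_one_le (Λ : Channel (Bits n)) (z : Bits n) :
    2 * zFidelity Λ - 1 ≤ zCorrelation Λ z := by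
  have h1 : (2 : ℝ) ^ n = ∑ b', ∑ b, transition Λ b' b := by simp [sum_transition]
  have h2 : 2 * zFidelity Λ - 1 =
      (2 ^ n)⁻¹ * ∑ b, ∑ b', ((if b = b' then 2 else 0) - 1) * transition Λ b' b := by
    simp only [sub_mul, Finset.sum_sub_distrib, one_mul, ite_mul, zero_mul, Finset.sum_ite_eq,
      Finset.mem_univ, if_true]
    rw [Finset.sum_comm (f := fun b b' => transition Λ b' b), ← h1, zFidelity_eq, mul_sub,
      inv_mul_cancel₀ (by positivity), ← Finset.mul_sum]
    ring
  rw [h2, zCorrelation_eq]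
  gcongr with b _ b' _
  · exact transition_nonneg Λ b' b
  · split_ifs with h
    · subst h
      rw [zSign_mul_self]; norm_num
    · have := neg_abs_le (zSign z b * zSign z b')
      rw [abs_mul, abs_zSign, abs_zSign] at this
      linarith

theorem diagFraction_mul_le_pauliFidelity (Λ : Channel (Bits n)) (z : Bits n) :
    diagFraction z * (2 * zFidelity Λ - 1) ≤ pauliFidelity Λ z :=
  mul_le_mul_of_nonneg_left (two_mul_zFidelity_sub_one_le Λ z) (diagFraction_pos z).le

end Fidelity

/-! ### Moments of one round -/

section Moments

variable {n : ℕ}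

theorem State.diag_eq_re {ι : Type} [Fintype ι] (ρ : State ι) (b : ι) :
    ρ.mat b b = ((ρ.mat b b).re : ℂ) :=
  Complex.ext rfl (Complex.nonneg_iff.1 (ρ.posSemidef.diag_nonneg (i := b))).2.symm

theorem State.diag_re_nonneg {ι : Type} [Fintype ι] (ρ : State ι) (b : ι) :
    0 ≤ (ρ.mat b b).re :=
  (Complex.nonneg_iff.1 (ρ.posSemidef.diag_nonneg (i := b))).1

theorem State.sum_diag_re {ι : Type} [Fintype ι] (ρ : State ι) : ∑ b, (ρ.mat b b).re = 1 := by
  simpa [Matrix.trace] using congrArg Complex.re ρ.trace_eq_one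

/-- The probability of the outcome `b` given the local Clifford element `u`. -/
def outcomeProb (Λ : Channel (Bits n)) (ρ : State (Bits n)) (u : Fin n → Cl2) (b : Bits n) : ℝ :=
  ((Λ.apply (ρ.conj (localClifford u))).mat b b).re

theorem sum_outcomeProb (Λ : Channel (Bits n)) (ρ : State (Bits n)) (u : Fin n → Cl2) :
    ∑ b, outcomeProb Λ ρ u b = 1 := State.sum_diag_re _

theorem roundLaw_apply_toReal (Λ : Channel (Bits n)) (ρ : State (Bits n)) (u : Fin n → Cl2)
    (b : Bits n) : (roundLaw Λ ρ (u, b)).toReal =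
      (Fintype.card (Fin n → Cl2) : ℝ)⁻¹ * outcomeProb Λ ρ u b := by
  classical
  have h : roundLaw Λ ρ (u, b) = (Fintype.card (Fin n → Cl2) : ENNReal)⁻¹ *
      ENNReal.ofReal (outcomeProb Λ ρ u b) := by
    rw [roundLaw, PMF.bind_apply, tsum_eq_single u]
    · rw [PMF.map_apply, tsum_eq_single b]
      · simp [State.measure, outcomeProb]
      · intro b' hb'
        simp [hb'.symm]
    · intro u' hu'
      simp [PMF.map_apply, hu'.symm]
  have h0 : 0 ≤ outcomeProb Λ ρ u b := State.diag_re_nonneg _ _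
  rw [h, ENNReal.toReal_mul, ENNReal.toReal_ofReal h0]
  simp

theorem integral_roundLaw (Λ : Channel (Bits n)) (ρ : State (Bits n)) (g : Round n → ℝ) :
    ∫ r, g r ∂(roundLaw Λ ρ).toMeasure =
      (Fintype.card (Fin n → Cl2) : ℝ)⁻¹ * ∑ u, ∑ b, outcomeProb Λ ρ u b * g (u, b) := by
  rw [PMF.integral_eq_sum, Fintype.sum_prod_type, Finset.mul_sum]
  refine Finset.sum_congr rfl fun u _ => ?_
  rw [Finset.mul_sum]
  refine Finset.sum_congr rfl fun b _ => ?_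
  rw [roundLaw_apply_toReal, smul_eq_mul, mul_assoc]

/-- The real part in `zCorrelation` loses nothing, since positivity of `Λ` makes the diagonal
entries of each `Λ(|b'⟩⟨b'|)` real. -/
theorem sum_zString_mul_map (Λ : Channel (Bits n)) (z : Bits n) :
    ∑ b, zString z b b * Λ.map (zString z) b b = (2 ^ n * zCorrelation Λ z : ℝ) := by
  rw [zCorrelation, mul_inv_cancel_left₀ (by positivity), Complex.ofReal_sum]
  refine Finset.sum_congr rfl fun b _ => ?_
  have h : ∀ b', Λ.map (ketbra b') b b = (transition Λ b' b : ℂ) := fun b' =>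
    Complex.ext rfl (Complex.nonneg_iff.1
      ((Λ.positive (ketbra_posSemidef b')).diag_nonneg (i := b))).2.symm
  have hr : Λ.map (zString z) b b = ((∑ b', zSign z b' * transition Λ b' b : ℝ) : ℂ) := by
    rw [zString_eq_sum, map_sum, Matrix.sum_apply, Complex.ofReal_sum]
    refine Finset.sum_congr rfl fun b' _ => ?_
    rw [map_smul, Matrix.smul_apply, smul_eq_mul, h, Complex.ofReal_mul]
  rw [hr, zString_apply, if_pos rfl, ← Complex.ofReal_mul, Complex.ofReal_re]

/-- Because `Λ` does not depend on the gate, linearity moves the average over `u` inside it, where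
`sum_localClifford_conj` leaves only a multiple of `P_z`. -/
theorem sum_outcomeProb_mul_conj_pauliString (Λ : Channel (Bits n)) (ρ : State (Bits n))
    (p : Fin n → Fin 4) :
    ∑ u, ∑ b, (outcomeProb Λ ρ u b : ℂ) *
        ((localClifford u).1 * pauliString p * (localClifford u).1ᴴ) b b =
      Fintype.card (Fin n → Cl2) * pauliFidelity Λ (support p) * hs (pauliString p) ρ.mat := by
  have hprob : ∀ u b, (outcomeProb Λ ρ u b : ℂ) =
      Λ.map ((localClifford u).1 * ρ.mat * (localClifford u).1ᴴ) b b := fun u b =>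
    (State.diag_eq_re (Λ.apply (ρ.conj (localClifford u))) b).symm
  rw [Finset.sum_comm]
  have hb : ∀ b, ∑ u, (outcomeProb Λ ρ u b : ℂ) *
        ((localClifford u).1 * pauliString p * (localClifford u).1ᴴ) b b =
      (Fintype.card (Fin n → Cl2) * diagFraction (support p) *
        ((2 ^ n)⁻¹ * hs (pauliString p) ρ.mat)) *
        (zString (support p) b b * Λ.map (zString (support p)) b b) := by
    intro b
    have h := congrArg (fun A => Λ.map A b b) (sum_localClifford_conj p ρ.mat b)
    simp only [map_sum, map_smul, Matrix.sum_apply, Matrix.smul_apply, smul_eq_mul] at h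
    simp only [hprob]
    rw [Finset.sum_congr rfl fun u _ => mul_comm _ _, h]
    ring
  simp only [hb]
  rw [← Finset.mul_sum, sum_zString_mul_map, pauliFidelity]
  push_cast
  have : (2 ^ n : ℂ) ≠ 0 := by positivity
  field_simp

/-- Expectation of a linear combination of the random variables `⟨b|U P_p U†|b⟩`. -/
theorem integral_roundLaw_re_sum (Λ : Channel (Bits n)) (ρ : State (Bits n))
    (c : (Fin n → Fin 4) → ℂ) :
    ∫ r : Round n, (∑ p, c p * ((localClifford r.1).1 * pauliString p *
        (localClifford r.1).1ᴴ) r.2 r.2).re ∂(roundLaw Λ ρ).toMeasure =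
      (∑ p, c p * (pauliFidelity Λ (support p) * hs (pauliString p) ρ.mat)).re := by
  have hc : (Fintype.card (Fin n → Cl2) : ℂ) ≠ 0 := Nat.cast_ne_zero.2 Fintype.card_ne_zero
  rw [integral_roundLaw]
  simp only [← Complex.re_ofReal_mul, ← Complex.re_sum]
  congr 1
  calc _ = ∑ p, (Fintype.card (Fin n → Cl2) : ℂ)⁻¹ * (c p * ∑ u, ∑ b, (outcomeProb Λ ρ u b : ℂ) *
        ((localClifford u).1 * pauliString p * (localClifford u).1ᴴ) b b) := by
        simp only [Finset.mul_sum]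
        rw [Finset.sum_congr rfl fun u _ => Finset.sum_comm, Finset.sum_comm]
        refine Finset.sum_congr rfl fun p _ => Finset.sum_congr rfl fun u _ =>
          Finset.sum_congr rfl fun b _ => ?_
        push_cast
        ring
    _ = _ := by
        refine Finset.sum_congr rfl fun p _ => ?_
        rw [sum_outcomeProb_mul_conj_pauliString]
        field_simp

theorem integral_noiseEst (Λ : Channel (Bits n)) (ρ : State (Bits n)) (z : Bits n) :
    ∫ r, noiseEst z r ∂(roundLaw Λ ρ).toMeasure =
      pauliFidelity Λ z * (hs (zString z) ρ.mat).re := by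
  have h := integral_roundLaw_re_sum Λ ρ
    (Pi.single (fun i => if z i = 0 then 0 else 3) 1)
  simp only [Pi.single_apply, ite_mul, one_mul, zero_mul, Finset.sum_ite_eq', Finset.mem_univ,
    if_true, support_ite, Complex.re_ofReal_mul] at h
  simpa only [noiseEst, hs_ketbra, zString] using h

/-- `⟨b|gPg†|b⟩` for a Pauli matrix `P`. -/
def diagEntry (p : Fin 4) (g : Cl2) (b : Fin 2) : ℝ := ((g.rep.1 * pauli p * g.rep.1ᴴ) b b).re

theorem diagEntry_coe (p : Fin 4) (g : Cl2) (b : Fin 2) :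
    (g.rep.1 * pauli p * g.rep.1ᴴ) b b = (diagEntry p g b : ℂ) := by
  have h : (g.rep.1 * pauli p * g.rep.1ᴴ).IsHermitian := by
    rw [Matrix.IsHermitian]
    simp only [Matrix.conjTranspose_mul, Matrix.conjTranspose_conjTranspose, pauli_conjTranspose,
      Matrix.mul_assoc]
  exact (h.coe_re_apply_self b).symm

/-- A conjugated non-identity Pauli matrix is traceless, so its two diagonal entries are opposite.
-/
theorem diagEntry_sq (p : Fin 4) (g : Cl2) (b : Fin 2) :
    diagEntry p g b ^ 2 = diagEntry p g 0 ^ 2 := by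
  by_cases hp : p = 0
  · subst hp
    simp only [diagEntry, conj_pauli_zero]
    simp [pauli]
  · have hU : g.rep.1ᴴ * g.rep.1 = 1 := mem_unitaryGroup_iff'.1 g.rep.2
    have ht : (g.rep.1 * pauli p * g.rep.1ᴴ).trace = 0 := by
      rw [Matrix.trace_mul_comm, ← Matrix.mul_assoc, hU, Matrix.one_mul]
      fin_cases p
      · exact absurd rfl hp
      all_goals simp [pauli, Matrix.trace, Fin.sum_univ_two]
    rw [Matrix.trace, Fin.sum_univ_two, Matrix.diag, Matrix.diag, diagEntry_coe, diagEntry_coe] at ht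
    have ht' : diagEntry p g 0 + diagEntry p g 1 = 0 := by exact_mod_cast ht
    have h1 : diagEntry p g 1 = -diagEntry p g 0 := by linarith
    fin_cases b
    · rfl
    · simp [h1]

theorem sum_diagEntry_sq (p : Fin 4) :
    ∑ g, diagEntry p g 0 ^ 2 = Fintype.card Cl2 * (if p = 0 then 1 else 1 / 3) := by
  have h := sum_rep_conj_pauli p p 0 0 0
  simp only [diagEntry_coe, if_true] at h
  have h2 : (pauli (if p = 0 then 0 else 3) 0 0 * pauli (if p = 0 then 0 else 3) 0 0) = 1 := by
    split_ifs <;> simp [pauli]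
  rw [h2, mul_one] at h
  simp only [pow_two]
  exact_mod_cast h

theorem noiseEst_sq (z : Bits n) (r : Round n) :
    noiseEst z r ^ 2 = ∏ i, diagEntry (if z i = 0 then 0 else 3) (r.1 i) 0 ^ 2 := by
  have h : noiseEst z r = ∏ i, diagEntry (if z i = 0 then 0 else 3) (r.1 i) (r.2 i) := by
    rw [noiseEst, hs_ketbra, zString, pauliString, localClifford_conj_tensor, tensor_diag]
    simp only [diagEntry_coe]
    rw [← Complex.ofReal_prod, Complex.ofReal_re]
  rw [h, ← Finset.prod_pow]
  exact Finset.prod_congr rfl fun i _ => diagEntry_sq _ _ _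

/-- By `noiseEst_sq` the outcome drops out and its probabilities sum to one, so only the uniform law
of the gates matters. -/
theorem integral_noiseEst_sq (Λ : Channel (Bits n)) (ρ : State (Bits n)) (z : Bits n) :
    ∫ r, noiseEst z r ^ 2 ∂(roundLaw Λ ρ).toMeasure = diagFraction z := by
  have hc : (Fintype.card Cl2 : ℝ) ≠ 0 := Nat.cast_ne_zero.2 Fintype.card_ne_zero
  rw [integral_roundLaw]
  simp only [noiseEst_sq, ← Finset.sum_mul, sum_outcomeProb, one_mul]
  rw [sum_localClifford_prod (fun i g => diagEntry (if z i = 0 then 0 else 3) g 0 ^ 2)]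
  simp only [sum_diagEntry_sq, Finset.prod_mul_distrib]
  have h0 : ∀ i, (if z i = 0 then (0 : Fin 4) else 3) = 0 ↔ z i = 0 := fun i => by
    by_cases h : z i = 0 <;> simp [h]
  simp only [h0, prod_ite_eq_diagFraction, Fintype.card_pi, Finset.prod_const, Finset.card_univ,
    Fintype.card_fin, Nat.cast_pow]
  field_simp

end Moments

/-! ### The error of the estimation procedure -/

section Estimation

variable {n : ℕ}

theorem hs_smul_right {ι : Type} [Fintype ι] (c : ℂ) (A B : Op ι) : hs A (c • B) = c * hs A B := by
  simp [hs]

theorem hs_sum_right {ι κ : Type} [Fintype ι] (s : Finset κ) (A : Op ι) (B : κ → Op ι) :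
    hs A (∑ i ∈ s, B i) = ∑ i ∈ s, hs A (B i) := by
  simp [hs, Matrix.mul_sum, Matrix.trace_sum]

theorem star_hs {ι : Type} [Fintype ι] (A B : Op ι) : star (hs A B) = hs B A := by
  rw [hs, hs, ← Matrix.trace_conjTranspose, Matrix.conjTranspose_mul,
    Matrix.conjTranspose_conjTranspose]

theorem invM_eq_sum (f : Bits n → ℝ) (A : Op (Bits n)) :
    invM f A = ∑ p, (((f (support p))⁻¹ : ℂ) * ((2 ^ n : ℂ)⁻¹ * hs (pauliString p) A)) •
      pauliString p := by
  simp only [invM, proj, Finset.smul_sum]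
  rw [Finset.sum_comm]
  refine Finset.sum_congr rfl fun p _ => ?_
  simp only [smul_ite, smul_zero, Finset.sum_ite_eq, Finset.mem_univ, if_true, smul_smul]

theorem expectedEstimate_eq (Λ : Channel (Bits n)) (f : Bits n → ℝ) (O : Op (Bits n))
    (ρ : State (Bits n)) : expectedEstimate Λ f O ρ =
      (∑ p, ((f (support p))⁻¹ : ℂ) * (2 ^ n : ℂ)⁻¹ * hs O (pauliString p) *
        (pauliFidelity Λ (support p) * hs (pauliString p) ρ.mat)).re := by
  rw [← integral_roundLaw_re_sum, expectedEstimate]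
  congr 1
  funext r
  rw [oHat, invM_eq_sum, hs_sum_right]
  congr 1
  refine Finset.sum_congr rfl fun p _ => ?_
  rw [hs_smul_right, hs_conj_ketbra, pauliString_conjTranspose]
  ring

theorem hs_eq_sum_pauliString (A B : Op (Bits n)) :
    hs A B = ∑ p, (2 ^ n : ℂ)⁻¹ * hs A (pauliString p) * hs (pauliString p) B := by
  conv_lhs => rw [pauliString_expansion B]
  rw [hs_sum_right]
  refine Finset.sum_congr rfl fun p _ => ?_
  rw [hs_smul_right]
  ring

theorem pauliString_mul_self (p : Fin n → Fin 4) : pauliString p * pauliString p = 1 := by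
  rw [pauliString, tensor_mul, ← tensor_one]
  congr 1
  funext i
  generalize p i = q
  fin_cases q <;> simp [pauli, Matrix.one_fin_two]

theorem norm_hs_pauliString_state_le (p : Fin n → Fin 4) (ρ : State (Bits n)) :
    ‖hs (pauliString p) ρ.mat‖ ≤ 1 := by
  have hreal : hs (pauliString p) ρ.mat = ((hs (pauliString p) ρ.mat).re : ℂ) := by
    have : star (hs (pauliString p) ρ.mat) = hs (pauliString p) ρ.mat := by
      rw [star_hs, hs, hs, ρ.posSemidef.isHermitian.eq, pauliString_conjTranspose,
        Matrix.trace_mul_comm]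
    exact (Complex.conj_eq_iff_re.1 this).symm
  have key : ∀ s : ℝ, s * s = 1 → 0 ≤ 1 + s * (hs (pauliString p) ρ.mat).re := by
    intro s hs1
    -- For `s = ±1`, `Q` is twice the projector onto the `s`-eigenspace of the Pauli string, and
    -- `Tr(QρQ†) ≥ 0` is the wanted bound.
    set Q : Op (Bits n) := 1 + (s : ℂ) • pauliString p with hQ
    have hsc : (s : ℂ) * s = 1 := by exact_mod_cast hs1
    have hQH : Qᴴ = Q := by
      simp [hQ, pauliString_conjTranspose]
    have hQQ : Q * Q = (2 : ℂ) • Q := by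
      rw [hQ, add_mul, mul_add, mul_add, Matrix.one_mul, Matrix.mul_one, Matrix.one_mul,
        Matrix.smul_mul, Matrix.mul_smul, smul_smul, hsc, pauliString_mul_self]
      module
    have hpos := (ρ.posSemidef.mul_mul_conjTranspose_same Q).trace_nonneg
    have htr : (Q * ρ.mat * Qᴴ).trace = 2 * (1 + s * hs (pauliString p) ρ.mat) := by
      rw [hQH, Matrix.trace_mul_comm, ← Matrix.mul_assoc, hQQ, Matrix.smul_mul, Matrix.trace_smul,
        hQ, Matrix.add_mul, Matrix.trace_add, Matrix.one_mul, ρ.trace_eq_one, Matrix.smul_mul,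
        Matrix.trace_smul, hs, pauliString_conjTranspose]
      simp
    rw [htr, hreal] at hpos
    have := (Complex.nonneg_iff.1 hpos).1
    have h2 : ((2 : ℂ) * (1 + s * ((hs (pauliString p) ρ.mat).re : ℂ))).re =
      2 * (1 + s * (hs (pauliString p) ρ.mat).re) := by
      norm_cast
    rw [h2] at this
    linarith
  rw [hreal, Complex.norm_real, Real.norm_eq_abs, abs_le]
  have h1 := key 1 (by norm_num)
  have h2 := key (-1) (by norm_num)
  constructor <;> linarith

theorem hs_self_eq_sum {ι : Type} [Fintype ι] (A : Op ι) :
    hs A A = ((∑ x, ∑ y, ‖A x y‖ ^ 2 : ℝ) : ℂ) := by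
  rw [hs_eq_sum]
  push_cast
  refine Finset.sum_congr rfl fun x _ => Finset.sum_congr rfl fun y _ => ?_
  exact Complex.conj_mul' _

/-- Each column is the image of a unit vector, so its squared norm is at most `‖A‖_∞²`. -/
theorem sum_norm_sq_le_opNorm {ι : Type} [Fintype ι] [DecidableEq ι] (A : Op ι) :
    ∑ x, ∑ y, ‖A x y‖ ^ 2 ≤ Fintype.card ι * opNorm A ^ 2 := by
  rw [Finset.sum_comm]
  have h : ∀ y, ∑ x, ‖A x y‖ ^ 2 ≤ opNorm A ^ 2 := by
    intro y
    have h1 := (Matrix.toEuclideanCLM (𝕜 := ℂ) A).le_opNorm (EuclideanSpace.single y 1)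
    rw [PiLp.norm_single, norm_one, mul_one] at h1
    have h2 := pow_le_pow_left₀ (norm_nonneg _) h1 2
    rw [EuclideanSpace.norm_sq_eq] at h2
    refine le_of_eq_of_le ?_ h2
    refine Finset.sum_congr rfl fun x _ => ?_
    simp [Matrix.mulVec_single]
  calc _ ≤ ∑ _y : ι, opNorm A ^ 2 := Finset.sum_le_sum fun y _ => h y
    _ = _ := by simp

theorem sum_norm_hs_pauliString_sq_le (O : Op (Bits n)) :
    ∑ p, ‖hs O (pauliString p)‖ ^ 2 ≤ (2 ^ n * opNorm O) ^ 2 := by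
  have h1 := hs_eq_sum_pauliString O O
  have h2 : ∀ p : Fin n → Fin 4, (2 ^ n : ℂ)⁻¹ * hs O (pauliString p) * hs (pauliString p) O =
      (((2 ^ n)⁻¹ * ‖hs O (pauliString p)‖ ^ 2 : ℝ) : ℂ) := by
    intro p
    rw [← star_hs O, mul_assoc]
    push_cast
    congr 1
    exact Complex.mul_conj' _
  simp only [h2] at h1
  rw [hs_self_eq_sum, ← Complex.ofReal_sum, Complex.ofReal_inj, ← Finset.mul_sum] at h1
  have h3 := sum_norm_sq_le_opNorm O
  rw [h1] at h3
  have hpos : (0 : ℝ) < 2 ^ n := by positivity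
  rw [inv_mul_le_iff₀ hpos] at h3
  refine h3.trans (le_of_eq ?_)
  simp
  ring

/-- A Pauli string that acts outside `S` is orthogonal to the operators supported on `S`. -/
theorem hs_pauliString_eq_zero_of_local {S : Finset (Fin n)} {O : Op (Bits n)}
    {T : Op (S → Fin 2)} (hO : ∀ x y : Bits n, O x y =
      T (fun i => x i) (fun i => y i) * if ∀ i, i ∉ S → x i = y i then 1 else 0)
    {p : Fin n → Fin 4} {j : Fin n} (hj : j ∉ S) (hp : p j ≠ 0) :
    hs (pauliString p) O = 0 := by
  -- Matrix units on `S` times the identity elsewhere: the inner product then factors, and position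
  -- `j` contributes the trace of a non-identity Pauli matrix.
  have hexp : O = ∑ a, ∑ b, T a b • tensor (fun i => if h : i ∈ S then
      Matrix.single (a ⟨i, h⟩) (b ⟨i, h⟩) 1 else (1 : Op (Fin 2))) := by
    have hent : ∀ (a b : S → Fin 2) (x y : Bits n), tensor (fun i => if h : i ∈ S then
        Matrix.single (a ⟨i, h⟩) (b ⟨i, h⟩) 1 else (1 : Op (Fin 2))) x y =
        if a = (fun i : S => x i) ∧ b = (fun i : S => y i) then
          (if ∀ i, i ∉ S → x i = y i then 1 else 0) else 0 := by
      intro a b x y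
      rw [tensor]
      split_ifs with h1 h2
      · refine Finset.prod_eq_one fun i _ => ?_
        by_cases hi : i ∈ S
        · simp [hi, h1.1, h1.2]
        · rw [dif_neg hi, h2 i hi, Matrix.one_apply_eq]
      · push Not at h2
        obtain ⟨i, hi, hxy⟩ := h2
        exact Finset.prod_eq_zero (Finset.mem_univ i) (by simp [hi, hxy])
      · have : ∃ i : S, ¬(a i = x i ∧ b i = y i) := by
          by_contra! hc
          exact h1 ⟨funext fun i => (hc i).1, funext fun i => (hc i).2⟩
        obtain ⟨i, hi⟩ := this
        refine Finset.prod_eq_zero (Finset.mem_univ i.1) ?_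
        simp [hi]
    ext x y
    simp only [Matrix.sum_apply, Matrix.smul_apply, hent, smul_eq_mul, hO x y, ite_and]
    simp
  rw [hexp, hs_sum_right]
  refine Finset.sum_eq_zero fun a _ => ?_
  rw [hs_sum_right]
  refine Finset.sum_eq_zero fun b _ => ?_
  rw [hs_smul_right, pauliString, hs_tensor, Finset.prod_eq_zero (Finset.mem_univ j), mul_zero]
  rw [dif_neg hj, hs, pauli_conjTranspose, Matrix.mul_one]
  generalize p j = q at hp
  fin_cases q
  · exact absurd rfl hp
  all_goals simp [pauli, Matrix.trace, Fin.sum_univ_two]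

/-- Inverting an approximate Pauli fidelity on `k`-local observables. -/
theorem abs_expectedEstimate_sub_le (Λ : Channel (Bits n)) (f : Bits n → ℝ) {k : ℕ} {y : ℝ}
    (hf : ∀ z, weight z ≤ k → |pauliFidelity Λ z / f z - 1| ≤ y)
    {O : Op (Bits n)} (hO : O.IsHermitian) (hloc : IsLocal k O) (ρ : State (Bits n)) :
    |expectedEstimate Λ f O ρ - (O * ρ.mat).trace.re| ≤ y * 2 ^ k * opNorm O := by
  obtain ⟨S, hS, T, hT⟩ := hloc
  have hy : 0 ≤ y := (abs_nonneg _).trans (hf 0 (by simp [weight]))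
  set B : Finset (Fin n → Fin 4) :=
    Fintype.piFinset fun i => if i ∈ S then Finset.univ else {0} with hB
  have hBcard : (B.card : ℝ) = (2 ^ k) ^ 2 := by
    rw [hB, Fintype.card_piFinset]
    have : ∀ i, (if i ∈ S then Finset.univ else {0} : Finset (Fin 4)).card =
        if i ∈ S then 4 else 1 := fun i => by split_ifs <;> simp
    simp only [this, Finset.prod_ite_mem, Finset.univ_inter, Finset.prod_const, hS]
    push_cast
    rw [← pow_mul, mul_comm, pow_mul]
    norm_num
  have hzero : ∀ p, p ∉ B → hs O (pauliString p) = 0 := by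
    intro p hp
    simp only [hB, Fintype.mem_piFinset, not_forall] at hp
    obtain ⟨j, hj⟩ := hp
    have hjS : j ∉ S := fun h => by simp [h] at hj
    rw [← star_hs, hs_pauliString_eq_zero_of_local hT hjS (by simpa [hjS] using hj), star_zero]
  have hweight : ∀ p ∈ B, weight (support p) ≤ k := by
    intro p hp
    rw [← hS]
    refine Finset.card_le_card fun i hi => ?_
    by_contra hiS
    have := (Fintype.mem_piFinset.1 hp) i
    simp only [hiS, if_false, Finset.mem_singleton] at this
    simp [support, this] at hi
  have htr : (O * ρ.mat).trace = hs O ρ.mat := by rw [hs, hO.eq]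
  rw [expectedEstimate_eq, htr, hs_eq_sum_pauliString, ← Complex.sub_re, ← Finset.sum_sub_distrib]
  refine (Complex.abs_re_le_norm _).trans ?_
  have hterm : ∀ p : Fin n → Fin 4,
      ((f (support p))⁻¹ : ℂ) * (2 ^ n : ℂ)⁻¹ * hs O (pauliString p) *
        (pauliFidelity Λ (support p) * hs (pauliString p) ρ.mat) -
        (2 ^ n : ℂ)⁻¹ * hs O (pauliString p) * hs (pauliString p) ρ.mat =
      ((pauliFidelity Λ (support p) / f (support p) - 1 : ℝ) : ℂ) * (2 ^ n : ℂ)⁻¹ *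
        hs O (pauliString p) * hs (pauliString p) ρ.mat := by
    intro p
    push_cast
    ring
  simp only [hterm]
  rw [← Finset.sum_subset (Finset.subset_univ B) fun p _ hp => by rw [hzero p hp]; ring]
  calc _ ≤ ∑ p ∈ B, y * (2 ^ n)⁻¹ * ‖hs O (pauliString p)‖ := by
        refine norm_sum_le_of_le _ fun p hp => ?_
        rw [norm_mul, norm_mul, norm_mul, Complex.norm_real, norm_inv, norm_pow, Complex.norm_two,
          Real.norm_eq_abs]
        have h1 := hf _ (hweight p hp)
        have h2 := norm_hs_pauliString_state_le p ρ
        refine (mul_le_of_le_one_right (by positivity) h2).trans ?_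
        gcongr
    _ = y * (2 ^ n)⁻¹ * ∑ p ∈ B, ‖hs O (pauliString p)‖ := by rw [Finset.mul_sum]
    -- Cauchy–Schwarz over the `4^k` strings in `B`, then Parseval.
    _ ≤ y * (2 ^ n)⁻¹ * (2 ^ k * (2 ^ n * opNorm O)) := by
        gcongr
        have hop : 0 ≤ opNorm O := norm_nonneg _
        refine le_of_sq_le_sq ?_ (by positivity)
        calc _ ≤ (B.card : ℝ) * ∑ p ∈ B, ‖hs O (pauliString p)‖ ^ 2 :=
              sq_sum_le_card_mul_sum_sq
          _ ≤ (2 ^ k) ^ 2 * (2 ^ n * opNorm O) ^ 2 := by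
              rw [hBcard]
              gcongr
              exact (Finset.sum_le_sum_of_subset_of_nonneg (Finset.subset_univ _)
                fun _ _ _ => by positivity).trans (sum_norm_hs_pauliString_sq_le O)
          _ = _ := by ring
    _ = _ := by field_simp

end Estimation

/-! ### Median of means -/

section Median

/-- If a middle order statistic is too low, so is everything sorted before it, and if too high,
everything after it. The two index conditions say that either side, with `i` included, holds at
least half of the values. -/
theorem abs_sort_sub_lt {K : ℕ} (v : Fin K → ℝ) (m c : ℝ)
    (hbad : 2 * (Finset.univ.filter fun t => c ≤ |v t - m|).card < K) (i : Fin K)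
    (h1 : K ≤ 2 * (K - i)) (h2 : K ≤ 2 * (i + 1)) : |v (Tuple.sort v i) - m| < c := by
  have hmono := Tuple.monotone_sort v
  have hcard : ∀ s : Finset (Fin K), (∀ j ∈ s, c ≤ |v (Tuple.sort v j) - m|) →
      2 * s.card < K := by
    intro s hs
    refine lt_of_le_of_lt (Nat.mul_le_mul_left 2 ?_) hbad
    rw [← Finset.card_map (Tuple.sort v).toEmbedding]
    refine Finset.card_le_card fun t ht => ?_
    obtain ⟨j, hj, rfl⟩ := Finset.mem_map.1 ht
    simpa using hs j hj
  rw [abs_lt]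
  constructor
  · by_contra! h
    have := hcard (Finset.Iic i) fun j hj => by
      have hji : v (Tuple.sort v j) ≤ v (Tuple.sort v i) := hmono (Finset.mem_Iic.1 hj)
      exact le_abs.2 (Or.inr (by linarith))
    rw [Fin.card_Iic] at this
    omega
  · by_contra! h
    have := hcard (Finset.Ici i) fun j hj => by
      have hji : v (Tuple.sort v i) ≤ v (Tuple.sort v j) := hmono (Finset.mem_Ici.1 hj)
      exact le_abs.2 (Or.inl (by linarith))
    rw [Fin.card_Ici] at this
    omega

/-- If the median is off by `c`, then so are at least half of the values. -/
theorem le_two_mul_card_of_le_abs_median_sub {K : ℕ} (v : Fin K → ℝ) (m c : ℝ)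
    (h : c ≤ |median v - m|) :
    K ≤ 2 * (Finset.univ.filter fun t => c ≤ |v t - m|).card := by
  by_contra! hbad
  have hK : 0 < K := by omega
  have ha := abs_lt.1 (abs_sort_sub_lt v m c hbad ⟨(K - 1) / 2, by omega⟩
    (by simp only; omega) (by simp only; omega))
  have hb := abs_lt.1 (abs_sort_sub_lt v m c hbad ⟨K / 2, by omega⟩
    (by simp only; omega) (by simp only; omega))
  rw [median, dif_pos hK] at h
  refine absurd h (not_le.2 (abs_lt.2 ⟨?_, ?_⟩)) <;> linarith [ha.1, ha.2, hb.1, hb.2]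

variable {Ω : Type*} [MeasurableSpace Ω]

/-- At least half of `K` independent trials fail with probability at most `e^{-K/2}`, if each of
them fails with probability at most `1/34`. -/
theorem measureReal_pi_half_le (μ : Measure Ω) [IsProbabilityMeasure μ] (B : Set Ω)
    (hp : μ.real B ≤ 1 / 34) (K : ℕ) [DecidablePred (· ∈ B)] :
    (Measure.pi fun _ : Fin K => μ).real
      {ω | K ≤ 2 * (Finset.univ.filter fun t => ω t ∈ B).card} ≤ Real.exp (-(K / 2)) := by
  -- Chosen so that `2^K q^K = e^{-K/2}`: the factor `2^K` pays for the union over all sets of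
  -- failing trials. Half of the trials failing costs `q^K` since `1/34 ≤ q² = 1/(4e)`.
  set q : ℝ := Real.exp (-(1 / 2)) / 2 with hq
  have hq0 : 0 < q := by positivity
  have hq1 : q ≤ 1 := by
    have : Real.exp (-(1 / 2)) ≤ 1 := Real.exp_le_one_iff.2 (by norm_num)
    rw [hq]; linarith
  have hq2 : 1 / 34 ≤ q ^ 2 := by
    have h1 : q ^ 2 = (Real.exp 1)⁻¹ / 4 := by
      rw [hq, div_pow, ← Real.exp_nat_mul, ← Real.exp_neg]
      norm_num
    rw [h1, ← one_div, div_div]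
    have := Real.exp_one_lt_d9
    exact one_div_le_one_div_of_le (by positivity) (by linarith)
  have hA : ∀ A : Finset (Fin K), K ≤ 2 * A.card → (Measure.pi fun _ : Fin K => μ).real
      (Set.univ.pi fun t => if t ∈ A then B else Set.univ) ≤ q ^ K := by
    intro A hAK
    rw [Measure.real, Measure.pi_pi, ENNReal.toReal_prod]
    have h1 : ∀ t, (μ (if t ∈ A then B else Set.univ)).toReal = if t ∈ A then μ.real B else 1 := by
      intro t
      split_ifs <;> simp [Measure.real]
    simp only [h1, Finset.prod_ite_mem, Finset.univ_inter, Finset.prod_const]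
    calc μ.real B ^ A.card ≤ (q ^ 2) ^ A.card :=
          pow_le_pow_left₀ measureReal_nonneg (hp.trans hq2) _
      _ = q ^ (2 * A.card) := (pow_mul q 2 A.card).symm
      _ ≤ q ^ K := pow_le_pow_of_le_one hq0.le hq1 hAK
  have hsub : {ω : Fin K → Ω | K ≤ 2 * (Finset.univ.filter fun t => ω t ∈ B).card} ⊆
      ⋃ A ∈ (Finset.univ.filter fun A : Finset (Fin K) => K ≤ 2 * A.card),
        Set.univ.pi fun t => if t ∈ A then B else Set.univ := by
    intro ω hω
    refine Set.mem_iUnion₂.2 ⟨Finset.univ.filter fun t => ω t ∈ B, by simpa using hω, ?_⟩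
    intro t _
    by_cases ht : ω t ∈ B <;> simp [ht]
  calc _ ≤ (Measure.pi fun _ : Fin K => μ).real _ :=
        measureReal_mono hsub (measure_ne_top _ _)
    _ ≤ ∑ A ∈ (Finset.univ.filter fun A : Finset (Fin K) => K ≤ 2 * A.card),
        (Measure.pi fun _ : Fin K => μ).real
          (Set.univ.pi fun t => if t ∈ A then B else Set.univ) :=
        measureReal_biUnion_finset_le _ _
    _ ≤ ∑ A ∈ (Finset.univ.filter fun A : Finset (Fin K) => K ≤ 2 * A.card), q ^ K :=
        Finset.sum_le_sum fun A hA' => hA A (Finset.mem_filter.1 hA').2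
    _ ≤ ∑ _A : Finset (Fin K), q ^ K :=
        Finset.sum_le_sum_of_subset_of_nonneg (Finset.filter_subset _ _)
          fun _ _ _ => by positivity
    _ = Real.exp (-(K / 2)) := by
        rw [Finset.sum_const, Finset.card_univ, Fintype.card_finset, Fintype.card_fin,
          nsmul_eq_mul, Nat.cast_pow, Nat.cast_ofNat, ← mul_pow, hq, mul_div_cancel₀ _ (by norm_num),
          ← Real.exp_nat_mul]
        congr 1
        ring

theorem variance_le_integral_sq {μ : Measure Ω} [IsProbabilityMeasure μ] {X : Ω → ℝ}
    (hX : MemLp X 2 μ) : ProbabilityTheory.variance X μ ≤ ∫ ω, X ω ^ 2 ∂μ := by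
  rw [ProbabilityTheory.variance_eq_sub hX]
  simp only [Pi.pow_apply]
  linarith [sq_nonneg (∫ ω, X ω ∂μ)]

/-- Chebyshev's inequality for the mean of `N` independent samples. -/
theorem measureReal_mean_sub_le (μ : Measure Ω) [IsProbabilityMeasure μ] {X : Ω → ℝ}
    (hX : MemLp X 2 μ) {N : ℕ} (hN : 0 < N) {c : ℝ} (hc : 0 < c)
    (hNc : 34 * ∫ ω, X ω ^ 2 ∂μ ≤ N * c ^ 2) :
    (Measure.pi fun _ : Fin N => μ).real
      {ω | c ≤ |(N : ℝ)⁻¹ * ∑ j, X (ω j) - ∫ ω, X ω ∂μ|} ≤ 1 / 34 := by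
  have hN' : (0 : ℝ) < N := Nat.cast_pos.2 hN
  set ν := Measure.pi fun _ : Fin N => μ
  set Y : (Fin N → Ω) → ℝ := ∑ j : Fin N, fun ω => X (ω j) with hY
  have hXj : ∀ j : Fin N, MemLp (fun ω : Fin N → Ω => X (ω j)) 2 ν := fun j =>
    hX.comp_measurePreserving (measurePreserving_eval (fun _ : Fin N => μ) j)
  have hYL : MemLp Y 2 ν := memLp_finsetSum' _ fun j _ => hXj j
  have hvar : ProbabilityTheory.variance Y ν = N * ProbabilityTheory.variance X μ := by
    rw [hY, ProbabilityTheory.variance_sum_pi (X := fun _ => X) fun _ => hX]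
    simp
  have hmean : ∫ ω, Y ω ∂ν = N * ∫ ω, X ω ∂μ := by
    simp only [hY, Finset.sum_apply]
    rw [integral_finsetSum _ fun j _ => (hXj j).integrable (by norm_num)]
    simp only [ν, integral_comp_eval (μ := fun _ : Fin N => μ) hX.aestronglyMeasurable]
    simp
  have hch := ProbabilityTheory.meas_ge_le_variance_div_sq hYL (mul_pos hN' hc)
  have hset : {ω : Fin N → Ω | c ≤ |(N : ℝ)⁻¹ * ∑ j, X (ω j) - ∫ ω, X ω ∂μ|} =
      {ω | N * c ≤ |Y ω - ∫ ω, Y ω ∂ν|} := by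
    ext ω
    simp only [Set.mem_ofPred_eq, hmean]
    have : Y ω - N * ∫ ω, X ω ∂μ = N * ((N : ℝ)⁻¹ * ∑ j, X (ω j) - ∫ ω, X ω ∂μ) := by
      rw [mul_sub, mul_inv_cancel_left₀ hN'.ne', hY, Finset.sum_apply]
    rw [this, abs_mul, abs_of_pos hN', mul_le_mul_iff_right₀ hN']
  rw [hset]
  refine (ENNReal.toReal_mono ENNReal.ofReal_ne_top hch).trans ?_
  rw [ENNReal.toReal_ofReal (div_nonneg (ProbabilityTheory.variance_nonneg _ _) (by positivity)),
    hvar, div_le_div_iff₀ (by positivity) (by norm_num)]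
  have hv := variance_le_integral_sq hX
  nlinarith

theorem pi_prod_eq_map_uncurry (μ : Measure Ω) [IsProbabilityMeasure μ] (K N : ℕ) :
    (Measure.pi fun _ : Fin K × Fin N => μ) =
      (Measure.pi fun _ : Fin K => Measure.pi fun _ : Fin N => μ).map Function.uncurry := by
  refine Measure.pi_eq fun s hs => ?_
  rw [Measure.map_apply (by exact measurable_uncurry) (MeasurableSet.univ_pi hs)]
  have : (Function.uncurry ⁻¹' Set.univ.pi s : Set (Fin K → Fin N → Ω)) =
      Set.univ.pi fun t => Set.univ.pi fun j => s (t, j) := by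
    ext ω
    simp [Set.mem_pi, Function.uncurry]
  rw [this, Measure.pi_pi]
  simp only [Measure.pi_pi]
  rw [Fintype.prod_prod_type]

/-- Concentration of the median of means. -/
theorem measureReal_medianOfMeans_sub_le (μ : Measure Ω) [IsProbabilityMeasure μ] {X : Ω → ℝ}
    (hX : MemLp X 2 μ) {N : ℕ} (K : ℕ) (hN : 0 < N) {c : ℝ} (hc : 0 < c)
    (hNc : 34 * ∫ ω, X ω ^ 2 ∂μ ≤ N * c ^ 2) :
    (Measure.pi fun _ : Fin K × Fin N => μ).real
      {ω | c ≤ |medianOfMeans (fun r => X (ω r)) - ∫ ω, X ω ∂μ|} ≤ Real.exp (-(K / 2)) := by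
  classical
  set B : Set (Fin N → Ω) := {ω | c ≤ |(N : ℝ)⁻¹ * ∑ j, X (ω j) - ∫ ω, X ω ∂μ|} with hB
  have hbin := measureReal_pi_half_le (Measure.pi fun _ : Fin N => μ) B
    (measureReal_mean_sub_le μ hX hN hc hNc) K
  refine le_trans ?_ hbin
  -- Regrouping the rounds shows that the `K` groups are independent with a common law.
  rw [pi_prod_eq_map_uncurry]
  let e : (Fin K → Fin N → Ω) ≃ᵐ (Fin K × Fin N → Ω) := (MeasurableEquiv.curry _ _ _).symm
  have he : (Function.uncurry : (Fin K → Fin N → Ω) → (Fin K × Fin N → Ω)) = e := rfl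
  rw [he, Measure.real, MeasurableEquiv.map_apply, ← Measure.real]
  refine measureReal_mono fun ω hω => ?_
  exact le_two_mul_card_of_le_abs_median_sub _ _ _ hω

end Median

/-! ### The calibration state -/

section Calibration

variable {n : ℕ}

theorem fidelityZero_le_one (τ : State (Fin 2)) : fidelityZero τ ≤ 1 := by
  rw [fidelityZero, hs_ketbra, ← State.sum_diag_re τ, Fin.sum_univ_two]
  linarith [State.diag_re_nonneg τ 1]

theorem hs_pauli_three_state (τ : State (Fin 2)) :
    hs (pauli 3) τ.mat = ((2 * fidelityZero τ - 1 : ℝ) : ℂ) := by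
  have h := State.sum_diag_re τ
  rw [Fin.sum_univ_two] at h
  have h1 : 2 * fidelityZero τ - 1 = (τ.mat 0 0).re - (τ.mat 1 1).re := by
    rw [fidelityZero, hs_ketbra]; linarith
  rw [h1, Complex.ofReal_sub, ← State.diag_eq_re, ← State.diag_eq_re]
  simp [hs_eq_sum, pauli, Fin.sum_univ_two]
  ring

theorem re_hs_zString_product (z : Bits n) (ρ : State (Bits n)) (τ : Fin n → State (Fin 2))
    (hρ : ρ.mat = tensor fun i => (τ i).mat) :
    (hs (zString z) ρ.mat).re =
      ∏ i ∈ Finset.univ.filter fun i => z i = 1, (2 * fidelityZero (τ i) - 1) := by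
  have h : ∀ i, hs (pauli (if z i = 0 then 0 else 3)) (τ i).mat =
      ((if z i = 1 then 2 * fidelityZero (τ i) - 1 else 1 : ℝ) : ℂ) := by
    intro i
    by_cases hz : z i = 0
    · simp [hz, pauli, hs, (τ i).trace_eq_one]
    · have hz1 : z i = 1 := by omega
      simp only [hz1, if_true]
      exact hs_pauli_three_state (τ i)
  rw [hρ, zString, pauliString, hs_tensor, Finset.prod_congr rfl fun i _ => h i,
    ← Complex.ofReal_prod, Complex.ofReal_re, Finset.prod_filter]

/-- The sign of `ξ` is not assumed. If `k > 0` there is a qubit, and its fidelity is at most one,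
which forces `ξ ≥ 0`. -/
theorem mul_infidelity_nonneg {k : ℕ} {ξ : ℝ} (τ : Fin n → State (Fin 2)) (hkn : k ≤ n)
    (hτ : ∀ i, 1 - ξ ≤ fidelityZero (τ i)) : 0 ≤ k * ξ := by
  rcases Nat.eq_zero_or_pos k with rfl | hk
  · simp
  · have h1 := hτ ⟨0, by omega⟩
    have h2 := fidelityZero_le_one (τ ⟨0, by omega⟩)
    have : 0 ≤ ξ := by linarith
    positivity

theorem re_hs_zString_product_mem {k : ℕ} {ξ : ℝ} {z : Bits n} {ρ : State (Bits n)}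
    {τ : Fin n → State (Fin 2)} (hkn : k ≤ n) (hξ : 2 * k * ξ < 1)
    (hρ : ρ.mat = tensor fun i => (τ i).mat) (hτ : ∀ i, 1 - ξ ≤ fidelityZero (τ i))
    (hz : weight z ≤ k) :
    1 - 2 * k * ξ ≤ (hs (zString z) ρ.mat).re ∧ (hs (zString z) ρ.mat).re ≤ 1 := by
  have hkξ := mul_infidelity_nonneg τ hkn hτ
  rw [re_hs_zString_product z ρ τ hρ]
  rcases Nat.eq_zero_or_pos (weight z) with h0 | hpos
  · rw [weight, Finset.card_eq_zero] at h0
    rw [h0, Finset.prod_empty]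
    constructor <;> linarith
  · have hk : (1 : ℝ) ≤ k := by exact_mod_cast hpos.trans_le hz
    have hξ0 : 0 ≤ ξ := by
      by_contra! h
      nlinarith
    have hξ1 : 2 * ξ < 1 := by nlinarith
    have hw : (weight z : ℝ) ≤ k := by exact_mod_cast hz
    constructor
    · calc 1 - 2 * k * ξ ≤ 1 + weight z * (-2 * ξ) := by nlinarith
        -- Bernoulli's inequality.
        _ ≤ (1 + -2 * ξ) ^ weight z := one_add_mul_le_pow (by linarith) _
        _ = ∏ i ∈ Finset.univ.filter fun i => z i = 1, (1 + -2 * ξ) := by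
            rw [Finset.prod_const, weight]
        _ ≤ _ := Finset.prod_le_prod (fun i _ => by linarith) fun i _ => by linarith [hτ i]
    · exact Finset.prod_le_one (fun i _ => by linarith [hτ i]) fun i _ => by
        linarith [fidelityZero_le_one (τ i)]

/-- A nonzero string of weight at most `k` is the indicator of the range of a map `Fin k → Fin n`.
The zero string is counted separately, because for `k > 0` no such range is empty. -/
theorem card_weight_le {k : ℕ} (hkn : k ≤ n) :
    (Finset.univ.filter fun z : Bits n => weight z ≤ k).card ≤ 2 * n ^ k := by
  classical
  have hsub : (Finset.univ.filter fun z : Bits n => weight z ≤ k) ⊆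
      insert 0 (Finset.univ.image fun (f : Fin k → Fin n) (i : Fin n) =>
        if i ∈ Set.range f then (1 : Fin 2) else 0) := by
    intro z hz
    have hzk : weight z ≤ k := (Finset.mem_filter.1 hz).2
    rcases Finset.eq_empty_or_nonempty (Finset.univ.filter fun i => z i = 1) with h0 | hne
    · refine Finset.mem_insert.2 (Or.inl (funext fun i => ?_))
      have : i ∉ Finset.univ.filter fun i => z i = 1 := by rw [h0]; simp
      simp only [Finset.mem_filter, Finset.mem_univ, true_and] at this
      change z i = 0
      omega
    · refine Finset.mem_insert_of_mem (Finset.mem_image.2 ?_)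
      set W := Finset.univ.filter fun i => z i = 1 with hW
      obtain ⟨e⟩ : Nonempty (W ↪ Fin k) := Function.Embedding.nonempty_of_card_le (by
        simpa [weight] using hzk)
      have : Nonempty W := hne.to_subtype
      refine ⟨fun j => (Function.invFun e j).1, Finset.mem_univ _, funext fun i => ?_⟩
      have hr : i ∈ Set.range (fun j => (Function.invFun e j).1) ↔ z i = 1 := by
        constructor
        · rintro ⟨j, rfl⟩
          exact (Finset.mem_filter.1 (Function.invFun e j).2).2
        · intro hi
          obtain ⟨j, hj⟩ := Function.invFun_surjective e.injective
            ⟨i, Finset.mem_filter.2 ⟨Finset.mem_univ _, hi⟩⟩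
          exact ⟨j, by simp only [hj]⟩
      by_cases hi : z i = 1
      · simp only [hr, hi, if_true]
      · simp only [hr, hi, if_false]
        omega
  have h1 : 1 ≤ n ^ k := by
    rcases Nat.eq_zero_or_pos n with rfl | hn
    · simp [Nat.le_zero.1 hkn]
    · exact Nat.one_le_pow _ _ hn
  calc _ ≤ _ := Finset.card_le_card hsub
    _ ≤ _ + 1 := Finset.card_insert_le _ _
    _ ≤ n ^ k + 1 := by
        gcongr
        refine Finset.card_image_le.trans ?_
        simp
    _ ≤ _ := by omega

end Calibration

/-! ### Sample sizes -/

section SampleSize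

theorem one_le_natCast_pow {n k : ℕ} (hkn : k ≤ n) : (1 : ℝ) ≤ (n : ℝ) ^ k := by
  rcases Nat.eq_zero_or_pos n with rfl | hn
  · simp [Nat.le_zero.1 hkn]
  · exact one_le_pow₀ (by exact_mod_cast hn)

theorem groupSize_mul_groupCount_le {n k : ℕ} {ε δ η F : ℝ} (hη : 0 < η) (hkn : k ≤ n)
    (hε : 0 < ε) (hε1 : ε < 1) (hδ : 0 < δ) (hδ1 : δ < 1) (hF : 1 / 2 + η ≤ F) (hF1 : F ≤ 1) :
    ((groupSize k ε F * groupCount n k δ : ℕ) : ℝ) ≤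
      68 / η ^ 2 * (3 ^ k * (ε ^ 2)⁻¹ * (F ^ 2)⁻¹ * (k * Real.log n + Real.log (2 / δ))) := by
  have hF0 : 0 < F := by linarith
  set a : ℝ := 34 * 3 ^ k / (ε ^ 2 * (2 * F - 1) ^ 2) with ha
  set L : ℝ := k * Real.log n + Real.log (2 / δ) with hL
  have hg : 0 < (2 * F - 1) := by linarith
  have hnk := one_le_natCast_pow hkn
  have hlog : Real.log (2 * (n : ℝ) ^ k / δ) = L := by
    rw [mul_comm, mul_div_assoc, Real.log_mul (by positivity) (by positivity), Real.log_pow]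
  have hL1 : 1 / 2 ≤ L := by
    have h1 : Real.log 2 ≤ L := by
      rw [← hlog]
      refine Real.log_le_log (by norm_num) ?_
      rw [le_div_iff₀ hδ]
      nlinarith
    linarith [Real.log_two_gt_d9]
  have h3 : (1 : ℝ) ≤ 3 ^ k := one_le_pow₀ (by norm_num)
  have ha1 : 1 ≤ a := by
    rw [ha, one_le_div (by positivity)]
    have e1 : ε ^ 2 ≤ 1 := pow_le_one₀ hε.le hε1.le
    have e2 : (2 * F - 1) ^ 2 ≤ 1 := pow_le_one₀ hg.le (by linarith)
    calc ε ^ 2 * (2 * F - 1) ^ 2 ≤ 1 * 1 := by gcongr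
      _ ≤ _ := by linarith
  -- Both ceilings at most double their arguments, because `a ≥ 1` and `2L ≥ 1`.
  have hN : (groupSize k ε F : ℝ) ≤ 2 * a := by
    have := (Nat.ceil_lt_add_one (by linarith : 0 ≤ a)).le
    rw [groupSize, ← ha]
    linarith
  have hK : (groupCount n k δ : ℝ) ≤ 4 * L := by
    have := (Nat.ceil_lt_add_one (by linarith : 0 ≤ 2 * L)).le
    rw [groupCount, hlog]
    linarith
  have haF : a ≤ 34 / (4 * η ^ 2) * (3 ^ k * (ε ^ 2)⁻¹ * (F ^ 2)⁻¹) := by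
    have h4 : 4 * η ^ 2 * F ^ 2 ≤ (2 * F - 1) ^ 2 := by
      -- The gap `2F - 1 ≥ 2η` dominates `2ηF` as `F ≤ 1`; this trades `(2F - 1)⁻²` for `F⁻²`.
      have h5 : 2 * η * F ≤ 2 * F - 1 := by nlinarith
      have h6 := pow_le_pow_left₀ (by positivity) h5 2
      calc _ = (2 * η * F) ^ 2 := by ring
        _ ≤ _ := h6
    calc a ≤ 34 * 3 ^ k / (ε ^ 2 * (4 * η ^ 2 * F ^ 2)) := by
          rw [ha]; gcongr
      _ = _ := by field_simp
  push_cast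
  calc _ ≤ 2 * a * (4 * L) := by gcongr
    _ ≤ 2 * (34 / (4 * η ^ 2) * (3 ^ k * (ε ^ 2)⁻¹ * (F ^ 2)⁻¹)) * (4 * L) := by
        gcongr
    _ = _ := by ring

theorem exp_neg_half_le {n k K : ℕ} {δ : ℝ} (hkn : k ≤ n) (hδ : 0 < δ)
    (hK : groupCount n k δ ≤ K) : Real.exp (-(K / 2)) ≤ δ / (2 * (n : ℝ) ^ k) := by
  have hnk := one_le_natCast_pow hkn
  have h1 : 2 * Real.log (2 * (n : ℝ) ^ k / δ) ≤ K :=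
    (Nat.le_ceil _).trans (Nat.cast_le.2 hK)
  calc Real.exp (-(K / 2)) ≤ Real.exp (-Real.log (2 * (n : ℝ) ^ k / δ)) :=
        Real.exp_le_exp.2 (by linarith)
    _ = _ := by rw [Real.exp_neg, Real.exp_log (by positivity), inv_div]

/-! ### Concentration and relative error of the calibrated fidelities -/

variable {n : ℕ}

/-- The group size makes the second moment small against the squared tolerance. -/
theorem second_moment_le {k N : ℕ} {ε : ℝ} (Λ : Channel (Bits n)) {z : Bits n} (hε : 0 < ε)
    (hF : 1 / 2 < zFidelity Λ) (hz : weight z ≤ k) (hN : groupSize k ε (zFidelity Λ) ≤ N) :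
    34 * diagFraction z ≤ N * (ε * pauliFidelity Λ z) ^ 2 := by
  have hd := diagFraction_pos z
  set g := 2 * zFidelity Λ - 1 with hgdef
  have hg : 0 < g := by linarith
  have hN1 : 34 * 3 ^ k / (ε ^ 2 * g ^ 2) ≤ N := (Nat.le_ceil _).trans (Nat.cast_le.2 hN)
  -- The second moment is linear in `3^{-|z|}` and the squared tolerance quadratic; the `3^k` in the
  -- group size makes up for the missing factor.
  have hd3 : 1 ≤ 3 ^ k * diagFraction z := by
    rw [diagFraction, one_div, inv_pow, ← div_eq_mul_inv, one_le_div (by positivity)]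
    exact pow_le_pow_right₀ (by norm_num) hz
  calc 34 * diagFraction z ≤ 34 * diagFraction z * (3 ^ k * diagFraction z) :=
        le_mul_of_one_le_right (by positivity) hd3
    _ = 34 * 3 ^ k / (ε ^ 2 * g ^ 2) * (ε * (diagFraction z * g)) ^ 2 := by field_simp
    _ ≤ N * (ε * pauliFidelity Λ z) ^ 2 := by
        gcongr
        exact diagFraction_mul_le_pauliFidelity Λ z

theorem groupSize_pos {k : ℕ} {ε F : ℝ} (hε : 0 < ε) (hF : 1 / 2 < F) : 0 < groupSize k ε F := by
  have : 0 < 2 * F - 1 := by linarith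
  exact Nat.ceil_pos.2 (by positivity)

theorem pauliFidelity_pos (Λ : Channel (Bits n)) (hF : 1 / 2 < zFidelity Λ) (z : Bits n) :
    0 < pauliFidelity Λ z :=
  (mul_pos (diagFraction_pos z) (by linarith)).trans_le (diagFraction_mul_le_pauliFidelity Λ z)

/-- Concentration of the calibrated Pauli fidelities. -/
theorem measureReal_fHat_sub_le {k N K : ℕ} {ε : ℝ} (Λ : Channel (Bits n)) (ρ : State (Bits n))
    {z : Bits n} (hε : 0 < ε) (hF : 1 / 2 < zFidelity Λ) (hz : weight z ≤ k)
    (hN : groupSize k ε (zFidelity Λ) ≤ N) :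
    (roundsLaw Λ ρ N K).real {data | ε * pauliFidelity Λ z ≤
      |fHat data z - pauliFidelity Λ z * (hs (zString z) ρ.mat).re|} ≤ Real.exp (-(K / 2)) := by
  have h := measureReal_medianOfMeans_sub_le (roundLaw Λ ρ).toMeasure
    (X := noiseEst z) MemLp.of_discrete K ((groupSize_pos hε hF).trans_le hN)
    (mul_pos hε (pauliFidelity_pos Λ hF z))
    (by rw [integral_noiseEst_sq]; exact second_moment_le Λ hε hF hz hN)
  rw [integral_noiseEst] at h
  exact h

/-- A small absolute error of the estimate of `f s` gives a small relative error of `f`. -/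
theorem abs_div_sub_one_le {f s t ε y : ℝ} (hf : 0 < f) (hy : 0 ≤ y) (hxy : ε + y < 1)
    (hs : 1 - y ≤ s) (hs1 : s ≤ 1) (ht : |t - f * s| < ε * f) :
    0 < t ∧ |f / t - 1| ≤ (ε + y) + (ε + y) ^ 2 / (1 - (ε + y)) := by
  obtain ⟨h1, h2⟩ := abs_lt.1 ht
  have h3 : f * (1 - y) ≤ f * s := mul_le_mul_of_nonneg_left hs hf.le
  have h4 : f * s ≤ f * 1 := mul_le_mul_of_nonneg_left hs1 hf.le
  have hlow : f * (1 - (ε + y)) ≤ t := by linarith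
  have hx : 0 < 1 - (ε + y) := by linarith
  have ht0 : 0 < t := (mul_pos hf hx).trans_le hlow
  have hx0 : 0 ≤ ε + y := by
    have : 0 < ε * f := (abs_nonneg _).trans_lt ht
    have := pos_of_mul_pos_left this hf.le
    linarith
  have hfy : 0 ≤ f * y := mul_nonneg hf.le hy
  have hdiff : |f - t| ≤ (ε + y) * f := abs_le.2 ⟨by linarith, by linarith⟩
  refine ⟨ht0, ?_⟩
  have e1 : f / t - 1 = (f - t) / t := by field_simp
  -- With `x = ε + y` the bound is simply `x / (1 - x)`: an error of at most `x f`, divided by `t ≥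
  -- (1 - x) f`.
  have e2 : (ε + y) + (ε + y) ^ 2 / (1 - (ε + y)) = (ε + y) / (1 - (ε + y)) := by
    field_simp
    ring
  rw [e1, e2, abs_div, abs_of_pos ht0, div_le_div_iff₀ ht0 hx]
  calc |f - t| * (1 - (ε + y)) ≤ (ε + y) * f * (1 - (ε + y)) := by gcongr
    _ = (ε + y) * (f * (1 - (ε + y))) := by ring
    _ ≤ (ε + y) * t := by gcongr

end SampleSize

end RShadow

end

/-! ### The main theorem -/

open RShadow in
theorem mainTheorem8 (η : ℝ) (hη : 0 < η) :
    ∃ C : ℝ, 0 < C ∧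
      ∀ (n k : ℕ) (ε δ ξ : ℝ) (Λ : Channel (Bits n))
        (ρ₀ : State (Bits n)) (τ : Fin n → State (Fin 2)),
        k ≤ n → 0 < ε → 0 < δ → δ < 1 → ε + 2 * k * ξ < 1 →
        1 / 2 + η ≤ zFidelity Λ →
        ρ₀.mat = tensor (fun i => (τ i).mat) →
        (∀ i, 1 - ξ ≤ fidelityZero (τ i)) →
        ((groupSize k ε (zFidelity Λ) * groupCount n k δ : ℕ) : ℝ) ≤
            C * (3 ^ k * (ε ^ 2)⁻¹ * (zFidelity Λ ^ 2)⁻¹ *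
              (k * Real.log n + Real.log (2 / δ))) ∧
        ∀ N K : ℕ, groupSize k ε (zFidelity Λ) ≤ N → groupCount n k δ ≤ K →
          1 - δ ≤ (roundsLaw Λ ρ₀ N K).real
            {data | (∀ z : Bits n, weight z ≤ k → fHat data z ≠ 0) ∧
              ∀ (O : Op (Bits n)) (ρ : State (Bits n)), O.IsHermitian → IsLocal k O →
                |expectedEstimate Λ (fHat data) O ρ - (O * ρ.mat).trace.re| ≤
                  ((ε + 2 * k * ξ) + (ε + 2 * k * ξ) ^ 2 / (1 - (ε + 2 * k * ξ))) *
                    2 ^ k * opNorm O} := by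
  refine ⟨68 / η ^ 2, by positivity, ?_⟩
  intro n k ε δ ξ Λ ρ₀ τ hkn hε hδ hδ1 hx hF hρ hτ
  have hkξ := mul_infidelity_nonneg τ hkn hτ
  have hF' : 1 / 2 < zFidelity Λ := by linarith
  refine ⟨groupSize_mul_groupCount_le hη hkn hε (by linarith) hδ hδ1 hF (zFidelity_le_one Λ), ?_⟩
  intro N K hN hK
  have : IsProbabilityMeasure (roundsLaw Λ ρ₀ N K) := by unfold roundsLaw; infer_instance
  set bad : Bits n → Set (Fin K × Fin N → Round n) := fun z =>
    {data | ε * pauliFidelity Λ z ≤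
      |fHat data z - pauliFidelity Λ z * (hs (zString z) ρ₀.mat).re|} with hbad
  set W : Finset (Bits n) := Finset.univ.filter fun z => weight z ≤ k with hW
  have hnk := one_le_natCast_pow hkn
  -- Union bound over the strings only: outside these events the error bound is deterministic, hence
  -- simultaneous in all `O` and `ρ`.
  have hmeas : (roundsLaw Λ ρ₀ N K).real (⋃ z ∈ W, bad z) ≤ δ := by
    calc _ ≤ ∑ z ∈ W, (roundsLaw Λ ρ₀ N K).real (bad z) := measureReal_biUnion_finset_le _ _
      _ ≤ ∑ z ∈ W, δ / (2 * (n : ℝ) ^ k) := Finset.sum_le_sum fun z hz =>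
          (measureReal_fHat_sub_le Λ ρ₀ hε hF' (Finset.mem_filter.1 hz).2 hN).trans
            (exp_neg_half_le hkn hδ hK)
      _ = W.card * (δ / (2 * (n : ℝ) ^ k)) := by rw [Finset.sum_const, nsmul_eq_mul]
      _ ≤ (2 * (n : ℝ) ^ k) * (δ / (2 * (n : ℝ) ^ k)) := by
          gcongr
          exact_mod_cast card_weight_le hkn
      _ = δ := by field_simp
  have hcompl : 1 - δ ≤ (roundsLaw Λ ρ₀ N K).real (⋃ z ∈ W, bad z)ᶜ := by
    rw [probReal_compl_eq_one_sub MeasurableSet.of_discrete]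
    linarith
  refine hcompl.trans (measureReal_mono ?_ (measure_ne_top _ _))
  intro data hdata
  have hgood : ∀ z, weight z ≤ k → 0 < fHat data z ∧ |pauliFidelity Λ z / fHat data z - 1| ≤
      (ε + 2 * k * ξ) + (ε + 2 * k * ξ) ^ 2 / (1 - (ε + 2 * k * ξ)) := by
    intro z hz
    have hs := re_hs_zString_product_mem hkn (by linarith) hρ hτ hz
    refine abs_div_sub_one_le (pauliFidelity_pos Λ hF' z) (by linarith) hx hs.1 hs.2 ?_
    by_contra! hc
    exact hdata (Set.mem_iUnion₂.2 ⟨z, Finset.mem_filter.2 ⟨Finset.mem_univ _, hz⟩, hc⟩)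
  exact ⟨fun z hz => (hgood z hz).1.ne', fun O ρ hO hloc =>
    abs_expectedEstimate_sub_le Λ _ (fun z hz => (hgood z hz).2) hO hloc ρ⟩
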